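/- **Model.** Fix $\lambda_1,\lambda_2,P_1,T_I,T_E>0$, $\alpha>2$, $d\ge 0$, $0<\epsilon\le\mathcal E$, $\rho\ge 0$ and a noise variance $\sigma^2\ge 0$. Let $\Phi_1=\{(x,t_x)\}$ and $\Phi_2=\{(y,t_y)\}$ be independent homogeneous Poisson point processes on $\mathbb R^2\times\mathbb R$ of densities $\lambda_1$ and $\lambda_2$ (primary and secondary transmitters with their starting times). Let the fading coefficients $h_0$, $h_x$, $g_y$ be exponential with mean one, mutually independent and independent of $\Phi_1,\Phi_2$. The receiver of a primary transmitter at $x$ is at $x+d\,u_x$, where the unit vectors $u_x$ are i.i.d. and independent of everything else. Put $\phi(t,\tau)=\mathbf 1(\tau\le t\le\tau+T_I)$ and $$I_1(t)=P_1\sum_{(x,t_x)\in\Phi_1}\phi(t,t_x)\,h_x\,(1+\|x\|^\alpha)^{-1},\qquad E_H=\int_0^{T_E}I_1(t)\,dt .$$ Let $p=0$ if $E_H<\epsilon$, $p=\mathbb E[E_H]/T_I$ if $\epsilon\le E_H<\mathcal E$, and $p=\mathcal E/T_I$ if $E_H\ge\mathcal E$; the average transmit power of the secondary transmitters is $P_2=\mathbb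 E[p]$. The transmit probability is $\pi_s=\mathbb P(E_H>\epsilon)\,\pi_\rho$, where $\pi_\rho$ is the probability that no receiver of a primary transmitter that is active at time $T_E$ lies within distance $\rho$ of the origin. Let $\Phi_2^a$ be the independent thinning of $\Phi_2$ with retention probability $\pi_s$ (the thinning being independent of everything else), so that its density is $\lambda_2^a=\lambda_2\pi_s$, and let $$I_2(t)=P_2\sum_{(y,t_y)\in\Phi_2^a}\phi(t,t_y)\,g_y\,(1+\|y\|^\alpha)^{-1}.$$ The time-averaged interferences are $\mathrm I_n=\frac1{T_I}\int_0^{T_I}I_n(t)\,dt$, $n\in\{1,2\}$, with Laplace transforms $\mathcal L_{I_n}(s)=\mathbb E[e^{-s\mathrm I_n}]$, and $$\mathrm{SINR}_1=\frac{P_1h_0(1+d^\alpha)^{-1}}{\mathrm I_1+\mathrm I_2+\sigma^2}.$$ **Theorem.** One has $0<P_2<\infty$, and $\mathrm I_1,\mathrm I_2$ are almost surely finite. For every $\zeta>0$ the coverage probability $p_1^c(\zeta)=\mathbb P(\mathrm{SINR}_1\ge\zeta)$ of the typical primary receiver is $$p_1^c(\zeta)=\mathcal L_{I_1}(s)\,\mathcal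 L_{I_2}(s)\,e^{-\sigma^2 s},\qquad s=\frac{\zeta(1+d^\alpha)}{P_1}.$$ For every $s>0$ and $n\in\{1,2\}$, $$\mathcal L_{I_n}(s)=\exp\left(-2\mu_n\pi^2T_I\csc\left(\frac{2\pi}{\alpha}\right)\frac{(1+P_ns)^{2/\alpha}(2P_ns-\alpha)+\alpha}{P_ns(2+\alpha)}\right),$$ where $\mu_1=\lambda_1$ and $\mu_2=\lambda_2^a=\lambda_2\pi_s$. -/

import Mathlib

open MeasureTheory ProbabilityTheory
open scoped ENNReal

noncomputable section

namespace AdHoc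

/-- The Euclidean plane. -/
abbrev Plane : Type := EuclideanSpace ℝ (Fin 2)

/-- Time-space points `(x, t)`: a location and the instant at which a phase starts there. -/
abbrev TimeSpace : Type := Plane × ℝ

/-! ### Poisson point processes -/

/-- Number of points of the (random) sequence `X` that fall in `A`. -/
def count {Ω E : Type*} (X : ℕ → Ω → E) (A : Set E) (ω : Ω) : ℕ∞ :=
  {i : ℕ | X i ω ∈ A}.encard

/-- The points `X 0, X 1, …` form a Poisson point process with intensity measure `μ` (of infinite
total mass, so that there are infinitely many points, enumerated by `ℕ`): the number of points in
a measurable set `A` of finite intensity is Poisson with mean `μ A`, and the numbers of points in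
pairwise disjoint such sets are independent. -/
structure IsPoissonProcess {Ω E : Type*} [MeasurableSpace Ω] [MeasurableSpace E]
    (Pr : Measure Ω) (μ : Measure E) (X : ℕ → Ω → E) : Prop where
  measurable : ∀ i, Measurable (X i)
  poisson : ∀ A : Set E, MeasurableSet A → μ A < ∞ → ∀ k : ℕ,
    Pr {ω | count X A ω = (k : ℕ∞)}
      = ENNReal.ofReal (Real.exp (-(μ A).toReal) * (μ A).toReal ^ k / (k.factorial : ℝ))
  indep : ∀ (n : ℕ) (A : Fin n → Set E), (∀ i, MeasurableSet (A i)) → (∀ i, μ (A i) < ∞) →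
    Pairwise (fun i j => Disjoint (A i) (A j)) →
    iIndepFun (fun i ω => count X (A i) ω) Pr

/-- Homogeneous time-space Poisson point process of density `lam`. -/
def IsTimeSpacePPP {Ω : Type*} [MeasurableSpace Ω] (Pr : Measure Ω) (lam : ℝ)
    (X : ℕ → Ω → TimeSpace) : Prop :=
  IsPoissonProcess Pr (ENNReal.ofReal lam • (volume : Measure TimeSpace)) X

/-! ### Parameters -/

/-- The deterministic parameters of the two networks. -/
structure Params where
  /-- density of the primary time-space process -/
  lam₁ : ℝ
  /-- density of the secondary time-space process -/
  lam₂ : ℝ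
  /-- transmit power of the primary transmitters -/
  P₁ : ℝ
  /-- path-loss exponent -/
  α : ℝ
  /-- distance between a transmitter and its paired receiver -/
  d : ℝ
  /-- duration of a transmission -/
  TI : ℝ
  /-- duration of the harvesting phase -/
  TE : ℝ
  /-- energy threshold -/
  ε : ℝ
  /-- saturation level of the harvester -/
  sat : ℝ
  /-- radius of the guard zone -/
  ρ : ℝ
  /-- standard deviation of the noise -/
  σ : ℝ
  lam₁_pos : 0 < lam₁
  lam₂_pos : 0 < lam₂
  P₁_pos : 0 < P₁
  two_lt_α : 2 < α
  d_nonneg : 0 ≤ d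
  TI_pos : 0 < TI
  TE_pos : 0 < TE
  ε_pos : 0 < ε
  ε_le_sat : ε ≤ sat
  ρ_nonneg : 0 ≤ ρ

/-- `φ(t, τ) = 1(τ ≤ t ≤ τ + T)`: a transmission of duration `T` started at `τ` is on at `t`. -/
def phi (T t τ : ℝ) : ℝ≥0∞ :=
  open Classical in if τ ≤ t ∧ t ≤ τ + T then 1 else 0

/-- Path loss `(1 + r ^ α)⁻¹`. -/
def pathLoss (α r : ℝ) : ℝ := (1 + r ^ α)⁻¹

/-- Gain at time `t` and at the origin of a transmitter `z = (x, t_x)` with fading `c`: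
`φ(t, t_x) c (1 + ‖x‖ ^ α)⁻¹`. -/
def gain (p : Params) (t : ℝ) (z : TimeSpace) (c : ℝ) : ℝ≥0∞ :=
  phi p.TI t z.2 * ENNReal.ofReal (c * pathLoss p.α ‖z.1‖)

/-! ### Random elements of the model -/

/-- The random elements of the model, as functions on the sample space. -/
structure Network (Ω : Type*) where
  /-- primary transmitters -/
  X : ℕ → Ω → TimeSpace
  /-- fading from the primary transmitters to the origin -/
  h : ℕ → Ω → ℝ
  /-- direction (unit vector) from a primary transmitter to its paired receiver -/
  u : ℕ → Ω → Plane
  /-- secondary transmitters -/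
  Y : ℕ → Ω → TimeSpace
  /-- fading from the secondary transmitters to the origin -/
  g : ℕ → Ω → ℝ
  /-- whether a secondary transmitter is retained by the thinning, that is, becomes active -/
  b : ℕ → Ω → Bool
  /-- fading of the typical primary link -/
  h₀ : Ω → ℝ

namespace Network

variable {Ω : Type*} (N : Network Ω) (p : Params)

/-- Interference `I₁(t)` at time `t` from the primary transmitters; it is also the power
`y(t)` available for harvesting at a secondary transmitter at the origin. -/
def primaryAt (t : ℝ) (ω : Ω) : ℝ≥0∞ :=
  ENNReal.ofReal p.P₁ * ∑' i, gain p t (N.X i ω) (N.h i ω)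

/-- Energy `E_H` harvested at the origin during `[0, T_E]`. -/
def harvested (ω : Ω) : ℝ≥0∞ :=
  ∫⁻ t in Set.Icc 0 p.TE, N.primaryAt p t ω

variable [MeasurableSpace Ω] (Pr : Measure Ω)

/-- Power `p` at the typical secondary transmitter: `0` below the threshold, `𝔼[E_H] / T_I`
between the threshold and the saturation level, `sat / T_I` above. -/
def power (ω : Ω) : ℝ≥0∞ :=
  open Classical in
  if N.harvested p ω < ENNReal.ofReal p.ε then 0
  else if N.harvested p ω < ENNReal.ofReal p.sat then
    (∫⁻ ω', N.harvested p ω' ∂Pr) / ENNReal.ofReal p.TI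
  else ENNReal.ofReal p.sat / ENNReal.ofReal p.TI

/-- Average transmit power `P₂ = 𝔼[p]` of the secondary transmitters. -/
def P₂ : ℝ≥0∞ := ∫⁻ ω, N.power p Pr ω ∂Pr

/-- Energy coverage probability `π(ε) = ℙ(E_H > ε)`. -/
def energyProb : ℝ := Pr.real {ω | ENNReal.ofReal p.ε < N.harvested p ω}

/-- Probability `π_ρ` that, at the end `T_E` of the harvesting phase of a secondary transmitter
at the origin, no active primary receiver lies in its guard zone. -/
def guardProb : ℝ :=
  Pr.real {ω | ∀ i, phi p.TI p.TE (N.X i ω).2 = 1 → p.ρ < ‖(N.X i ω).1 + p.d • N.u i ω‖}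

/-- Transmit probability `π_s = π(ε) π_ρ` of a secondary transmitter. -/
def transmitProb : ℝ := N.energyProb p Pr * N.guardProb p Pr

/-- Density `λ₂ᵃ = λ₂ π_s` of the active secondary transmitters. -/
def activeDensity : ℝ := p.lam₂ * N.transmitProb p Pr

/-- Interference `I₂(t)` at time `t` from the active secondary transmitters, which transmit with
power `P₂`. -/
def secondaryAt (t : ℝ) (ω : Ω) : ℝ≥0∞ :=
  N.P₂ p Pr * ∑' j, if N.b j ω = true then gain p t (N.Y j ω) (N.g j ω) else 0

/-- Time-averaged interference `I₁` from the primary transmitters. -/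
def I₁ (ω : Ω) : ℝ≥0∞ :=
  (ENNReal.ofReal p.TI)⁻¹ * ∫⁻ t in Set.Icc 0 p.TI, N.primaryAt p t ω

/-- Time-averaged interference `I₂` from the active secondary transmitters. -/
def I₂ (ω : Ω) : ℝ≥0∞ :=
  (ENNReal.ofReal p.TI)⁻¹ * ∫⁻ t in Set.Icc 0 p.TI, N.secondaryAt p Pr t ω

/-- Signal-to-interference-plus-noise ratio at the typical primary receiver. -/
def SINR₁ (ω : Ω) : ℝ≥0∞ :=
  ENNReal.ofReal (p.P₁ * N.h₀ ω * pathLoss p.α p.d) /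
    (N.I₁ p ω + N.I₂ p Pr ω + ENNReal.ofReal (p.σ ^ 2))

/-- Coverage probability `p₁ᶜ(ζ) = ℙ(SINR₁ ≥ ζ)` of the typical primary receiver. -/
def coverage₁ (ζ : ℝ) : ℝ := Pr.real {ω | ENNReal.ofReal ζ ≤ N.SINR₁ p Pr ω}

/-- The probabilistic assumptions: `X` and `Y` are time-space Poisson processes of densities
`λ₁`, `λ₂`; all fading coefficients are exponential with mean one; the directions `u` are
identically distributed unit vectors; the retention marks `b` are Bernoulli with parameter `π_s`
(so the retained points of `Y` are a thinning of density `λ₂ π_s`); and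
the processes, the fading coefficients, the directions and the retention marks are all mutually
independent. -/
structure IsModel : Prop where
  primary : IsTimeSpacePPP Pr p.lam₁ N.X
  secondary : IsTimeSpacePPP Pr p.lam₂ N.Y
  measurable_h : ∀ i, Measurable (N.h i)
  measurable_g : ∀ i, Measurable (N.g i)
  measurable_u : ∀ i, Measurable (N.u i)
  measurable_b : ∀ i, Measurable (N.b i)
  measurable_h₀ : Measurable N.h₀
  law_h : ∀ i, Pr.map (N.h i) = expMeasure 1
  law_g : ∀ i, Pr.map (N.g i) = expMeasure 1
  law_h₀ : Pr.map N.h₀ = expMeasure 1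
  law_b : ∀ i, Pr {ω | N.b i ω = true} = ENNReal.ofReal (N.transmitProb p Pr)
  norm_u : ∀ i, ∀ᵐ ω ∂Pr, ‖N.u i ω‖ = 1
  ident_u : ∀ i, IdentDistrib (N.u i) (N.u 0) Pr Pr
  iIndep_h : iIndepFun N.h Pr
  iIndep_g : iIndepFun N.g Pr
  iIndep_u : iIndepFun N.u Pr
  iIndep_b : iIndepFun N.b Pr
  indep_h_u : IndepFun (fun ω i => N.h i ω) (fun ω i => N.u i ω) Pr
  indep_g_b : IndepFun (fun ω i => N.g i ω) (fun ω i => N.b i ω) Pr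
  indep_primary_marks :
    IndepFun (fun ω i => N.X i ω) (fun ω => (fun i => N.h i ω, fun i => N.u i ω)) Pr
  indep_secondary_marks :
    IndepFun (fun ω i => N.Y i ω) (fun ω => (fun i => N.g i ω, fun i => N.b i ω)) Pr
  indep_primary_secondary :
    IndepFun (fun ω => (fun i => N.X i ω, fun i => N.h i ω, fun i => N.u i ω))
      (fun ω => (fun i => N.Y i ω, fun i => N.g i ω, fun i => N.b i ω)) Pr
  indep_typical :
    IndepFun N.h₀
      (fun ω => ((fun i => N.X i ω, fun i => N.h i ω, fun i => N.u i ω),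
        (fun i => N.Y i ω, fun i => N.g i ω, fun i => N.b i ω))) Pr

end Network

/-- Laplace transform `𝔼[exp (-s I)]` of an almost surely finite `I ≥ 0`. -/
def laplace {Ω : Type*} [MeasurableSpace Ω] (Pr : Measure Ω) (I : Ω → ℝ≥0∞) (s : ℝ) : ℝ :=
  ∫ ω, Real.exp (-s * (I ω).toReal) ∂Pr

/-- Cosecant. -/
def csc (x : ℝ) : ℝ := (Real.sin x)⁻¹

/-- The closed form, for density `lam` and transmit power `P`. -/
def laplaceClosedForm (lam P TI α s : ℝ) : ℝ :=
  Real.exp (-(2 * lam * Real.pi ^ 2 * TI * csc (2 * Real.pi / α) *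
    (((1 + P * s) ^ (2 / α) * (2 * P * s - α) + α) / (P * s * (2 + α)))))

end AdHoc

end

noncomputable section

namespace AdHoc

open Filter Topology

/-! ### The exponential `exp (-x)` on `[0, ∞]` -/

/-- `exp (-x)` for `x ∈ [0, ∞]`, with `exp (-∞) = 0`. -/
def expNeg (x : ℝ≥0∞) : ℝ≥0∞ := EReal.exp (-(x : EReal))

@[simp] lemma expNeg_zero : expNeg 0 = 1 := by simp [expNeg]

@[simp] lemma expNeg_top : expNeg ∞ = 0 := by simp [expNeg]

lemma expNeg_ofReal {x : ℝ} (hx : 0 ≤ x) :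
    expNeg (ENNReal.ofReal x) = ENNReal.ofReal (Real.exp (-x)) := by
  rw [expNeg, EReal.coe_ennreal_ofReal, max_eq_left hx, ← EReal.coe_neg, EReal.exp_coe]

lemma expNeg_of_ne_top {x : ℝ≥0∞} (hx : x ≠ ∞) :
    expNeg x = ENNReal.ofReal (Real.exp (-x.toReal)) := by
  rw [← expNeg_ofReal ENNReal.toReal_nonneg, ENNReal.ofReal_toReal hx]

lemma continuous_expNeg : Continuous expNeg :=
  ENNReal.continuous_exp.comp (continuous_neg.comp continuous_coe_ennreal_ereal)

@[fun_prop] lemma measurable_expNeg : Measurable expNeg := continuous_expNeg.measurable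

lemma antitone_expNeg : Antitone expNeg := fun _ _ h =>
  EReal.exp_monotone (EReal.neg_le_neg_iff.2 (EReal.coe_ennreal_le_coe_ennreal_iff.2 h))

lemma expNeg_le_one (x : ℝ≥0∞) : expNeg x ≤ 1 := by
  simpa using antitone_expNeg (zero_le (a := x))

lemma expNeg_add (x y : ℝ≥0∞) : expNeg (x + y) = expNeg x * expNeg y := by
  rw [expNeg, expNeg, expNeg, ← EReal.exp_add, EReal.coe_ennreal_add, EReal.neg_add
    (Or.inl (EReal.coe_ennreal_ne_bot _)) (Or.inr (EReal.coe_ennreal_ne_bot _)), sub_eq_add_neg]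

lemma expNeg_sum {ι : Type*} (s : Finset ι) (f : ι → ℝ≥0∞) :
    expNeg (∑ i ∈ s, f i) = ∏ i ∈ s, expNeg (f i) := by
  classical
  induction s using Finset.induction_on with
  | empty => simp
  | insert i s hi ih => rw [Finset.sum_insert hi, Finset.prod_insert hi, expNeg_add, ih]

lemma tendsto_prod_expNeg (f : ℕ → ℝ≥0∞) :
    Tendsto (fun n => ∏ i ∈ Finset.range n, expNeg (f i)) atTop (𝓝 (expNeg (∑' i, f i))) := by
  simp_rw [← expNeg_sum]
  exact (continuous_expNeg.tendsto _).comp ENNReal.summable.hasSum.tendsto_sum_nat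

/-- `-log y` for `y ∈ [0, 1]`, inverse of `expNeg`. -/
def negLog (y : ℝ≥0∞) : ℝ≥0∞ := (-(ENNReal.log y)).toENNReal

@[fun_prop] lemma measurable_negLog : Measurable negLog :=
  (ENNReal.measurable_log.neg).ereal_toENNReal

lemma expNeg_negLog {y : ℝ≥0∞} (hy : y ≤ 1) : expNeg (negLog y) = y := by
  rw [expNeg, negLog, EReal.coe_toENNReal, neg_neg, ENNReal.exp_log]
  rw [EReal.le_neg, neg_zero]
  exact ENNReal.log_le_zero_iff.2 hy

/-! ### Poisson point processes -/

lemma toENNReal_count {Ω E : Type*} {X : ℕ → Ω → E} (A : Set E) (ω : Ω) :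
    ((count X A ω : ℕ∞) : ℝ≥0∞) = ∑' i, A.indicator 1 (X i ω) := by
  rw [count, ← ENNReal.tsum_set_one, tsum_subtype {i | X i ω ∈ A} (fun _ => (1 : ℝ≥0∞))]
  rfl

section Poisson

variable {Ω E : Type*} [MeasurableSpace Ω] [MeasurableSpace E] {Pr : Measure Ω}
  {μ : Measure E} {X : ℕ → Ω → E}

lemma measurable_count (hX : ∀ i, Measurable (X i)) {A : Set E} (hA : MeasurableSet A) :
    Measurable (count X A) := by
  refine measurable_to_countable' fun k => ?_
  have : count X A ⁻¹' {k} =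
      (fun ω => ∑' i, A.indicator (1 : E → ℝ≥0∞) (X i ω)) ⁻¹' {(k : ℝ≥0∞)} := by
    ext ω
    simp [← toENNReal_count]
  rw [this]
  refine (Measurable.tsum fun i => ?_) (measurableSet_singleton _)
  exact (measurable_one.indicator hA).comp (hX i)

namespace IsPoissonProcess

lemma lintegral_count [IsProbabilityMeasure Pr] (hX : IsPoissonProcess Pr μ X) {A : Set E}
    (hA : MeasurableSet A) (hμ : μ A < ∞) (F : ℕ∞ → ℝ≥0∞) :
    ∫⁻ ω, F (count X A ω) ∂Pr = ∑' k : ℕ, F k *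
      ENNReal.ofReal (Real.exp (-(μ A).toReal) * (μ A).toReal ^ k / (k.factorial : ℝ)) := by
  have hm := measurable_count hX.measurable hA
  have hS : ∀ k : ℕ, MeasurableSet {ω | count X A ω = (k : ℕ∞)} := fun k =>
    hm (measurableSet_singleton _)
  have hd : Pairwise (Function.onFun Disjoint fun k : ℕ => {ω | count X A ω = (k : ℕ∞)}) := by
    intro i j hij
    refine Set.disjoint_left.2 fun ω hi hj => hij ?_
    simp only [Set.mem_ofPred_eq] at hi hj
    exact_mod_cast hi.symm.trans hj
  have hU : (⋃ k : ℕ, {ω | count X A ω = (k : ℕ∞)}) =ᵐ[Pr] Set.univ := by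
    rw [ae_eq_univ, prob_compl_eq_zero_iff (MeasurableSet.iUnion hS), measure_iUnion hd hS]
    simp_rw [hX.poisson A hA hμ]
    have := hasSum_one_poissonMeasure (μ A).toNNReal
    change HasSum (fun k : ℕ => Real.exp (-(μ A).toReal) * (μ A).toReal ^ k / (k.factorial : ℝ)) 1
      at this
    rw [← ENNReal.ofReal_tsum_of_nonneg (fun k => by positivity) this.summable]
    exact (congrArg ENNReal.ofReal this.tsum_eq).trans ENNReal.ofReal_one
  rw [← setLIntegral_univ, ← setLIntegral_congr hU, lintegral_iUnion hS hd]
  refine tsum_congr fun k => ?_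
  rw [setLIntegral_congr_fun (g := fun _ => F k) (hS k) (fun ω hω => by
    simp only [Set.mem_ofPred_eq] at hω; simp [hω]), setLIntegral_const, hX.poisson A hA hμ]

lemma lintegral_expNeg_count [IsProbabilityMeasure Pr] (hX : IsPoissonProcess Pr μ X) {A : Set E}
    (hA : MeasurableSet A) (hμ : μ A < ∞) {a : ℝ≥0∞} (ha : a ≠ ∞) :
    ∫⁻ ω, expNeg (a * (count X A ω : ℕ∞)) ∂Pr = expNeg ((1 - expNeg a) * μ A) := by
  rw [hX.lintegral_count hA hμ (fun k => expNeg (a * (k : ℕ∞)))]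
  lift a to NNReal using ha
  set r := (μ A).toReal with hr
  have hr0 : 0 ≤ r := ENNReal.toReal_nonneg
  have h1 : ∀ k : ℕ, expNeg ((a : ℝ≥0∞) * ((k : ℕ∞) : ℝ≥0∞)) *
      ENNReal.ofReal (Real.exp (-r) * r ^ k / (k.factorial : ℝ)) =
      ENNReal.ofReal (Real.exp (-r) * ((r * Real.exp (-a)) ^ k / (k.factorial : ℝ))) := by
    intro k
    rw [expNeg_of_ne_top
      (by simpa using ENNReal.mul_ne_top ENNReal.coe_ne_top (ENNReal.natCast_ne_top k)),
      ← ENNReal.ofReal_mul (Real.exp_nonneg _)]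
    congr 1
    have : Real.exp (-((a : ℝ≥0∞) * ((k : ℕ∞) : ℝ≥0∞)).toReal) = Real.exp (-a) ^ k := by
      rw [← Real.exp_nat_mul]; simp; ring
    rw [this]; ring
  simp_rw [h1]
  have hs : HasSum (fun k : ℕ => (r * Real.exp (-a)) ^ k / (k.factorial : ℝ))
      (Real.exp (r * Real.exp (-a))) := by
    rw [Real.exp_eq_exp_ℝ]
    exact NormedSpace.expSeries_div_hasSum_exp _
  have hs' := hs.mul_left (Real.exp (-r))
  rw [← ENNReal.ofReal_tsum_of_nonneg (fun k => by positivity) hs'.summable, hs'.tsum_eq,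
    ← Real.exp_add, expNeg_of_ne_top (ENNReal.mul_ne_top (by simp) hμ.ne)]
  congr 2
  rw [ENNReal.toReal_mul, ENNReal.toReal_sub_of_le (expNeg_le_one _) (by simp),
    expNeg_of_ne_top ENNReal.coe_ne_top, ENNReal.toReal_ofReal (Real.exp_nonneg _)]
  simp only [ENNReal.toReal_one, ENNReal.coe_toReal]
  ring

lemma lintegral_count_eq [IsProbabilityMeasure Pr] (hX : IsPoissonProcess Pr μ X) {A : Set E}
    (hA : MeasurableSet A) (hμ : μ A < ∞) :
    ∫⁻ ω, (count X A ω : ℕ∞) ∂Pr = μ A := by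
  rw [hX.lintegral_count hA hμ (fun k => (k : ℝ≥0∞))]
  set r := (μ A).toReal with hr
  have hr0 : 0 ≤ r := ENNReal.toReal_nonneg
  have h1 : ∀ k : ℕ, (((k + 1 : ℕ) : ℕ∞) : ℝ≥0∞) *
      ENNReal.ofReal (Real.exp (-r) * r ^ (k + 1) / ((k + 1).factorial : ℝ)) =
      ENNReal.ofReal (r * (Real.exp (-r) * r ^ k / (k.factorial : ℝ))) := by
    intro k
    rw [ENat.toENNReal_coe, ← ENNReal.ofReal_natCast, ← ENNReal.ofReal_mul (by positivity)]
    congr 1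
    rw [Nat.factorial_succ]
    push_cast
    field_simp
    ring
  rw [tsum_eq_zero_add' ENNReal.summable]
  simp_rw [h1]
  have hs := (hasSum_one_poissonMeasure (μ A).toNNReal).mul_left r
  change HasSum (fun k : ℕ => r * (Real.exp (-r) * r ^ k / (k.factorial : ℝ))) _ at hs
  rw [← ENNReal.ofReal_tsum_of_nonneg (fun k => by positivity) hs.summable]
  simp only [CharP.cast_eq_zero, ENat.toENNReal_zero, zero_mul, zero_add]
  refine (congrArg ENNReal.ofReal hs.tsum_eq).trans ?_
  rw [mul_one, hr, ENNReal.ofReal_toReal hμ.ne]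

/-- The intensity measure of a Poisson process is the sum of the laws of its points. -/
lemma sum_map [IsProbabilityMeasure Pr] [SigmaFinite μ] (hX : IsPoissonProcess Pr μ X) :
    Measure.sum (fun i => Pr.map (X i)) = μ := by
  have key : ∀ A, MeasurableSet A → μ A < ∞ → Measure.sum (fun i => Pr.map (X i)) A = μ A := by
    intro A hA hμ
    rw [← hX.lintegral_count_eq hA hμ, Measure.sum_apply _ hA]
    simp_rw [toENNReal_count]
    rw [lintegral_tsum (f := fun i ω => A.indicator (1 : E → ℝ≥0∞) (X i ω))
      fun i => ((measurable_one.indicator hA).comp (hX.measurable i)).aemeasurable]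
    refine tsum_congr fun i => ?_
    rw [Measure.map_apply (hX.measurable i) hA, ← lintegral_indicator_one (hX.measurable i hA)]
    rfl
  refine (Measure.FiniteSpanningSetsIn.ext (C := {A | MeasurableSet A ∧ μ A < ∞})
    (μ := μ) ?_ ?_ ?_ ?_).symm
  · refine le_antisymm ?_ (MeasurableSpace.generateFrom_le fun t ht => ht.1)
    intro A hA
    have : A = ⋃ n, A ∩ spanningSets μ n := by
      rw [← Set.inter_iUnion, iUnion_spanningSets, Set.inter_univ]
    rw [this]
    exact MeasurableSet.iUnion fun n => MeasurableSpace.measurableSet_generateFrom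
      ⟨hA.inter (measurableSet_spanningSets μ n),
        (measure_mono Set.inter_subset_right).trans_lt (measure_spanningSets_lt_top μ n)⟩
  · rintro s ⟨hs, hs'⟩ t ⟨ht, _⟩ _
    exact ⟨hs.inter ht, (measure_mono Set.inter_subset_left).trans_lt hs'⟩
  · exact ⟨spanningSets μ,
      fun n => ⟨measurableSet_spanningSets μ n, measure_spanningSets_lt_top μ n⟩,
      measure_spanningSets_lt_top μ, iUnion_spanningSets μ⟩
  · exact fun s hs => (key s hs.1 hs.2).symm

/-- Campbell's formula. -/
lemma tsum_lintegral [IsProbabilityMeasure Pr] [SigmaFinite μ] (hX : IsPoissonProcess Pr μ X)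
    {f : E → ℝ≥0∞} (hf : Measurable f) : ∑' i, ∫⁻ ω, f (X i ω) ∂Pr = ∫⁻ x, f x ∂μ := by
  conv_rhs => rw [← hX.sum_map, lintegral_sum_measure]
  exact tsum_congr fun i => (lintegral_map hf (hX.measurable i)).symm

lemma iIndepFun_count (hX : IsPoissonProcess Pr μ X) {ι : Type*} [Fintype ι] {A : ι → Set E}
    (hA : ∀ k, MeasurableSet (A k)) (hμ : ∀ k, μ (A k) < ∞)
    (hd : Pairwise (Function.onFun Disjoint A)) : iIndepFun (fun k ω => count X (A k) ω) Pr := by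
  let e := Fintype.equivFin ι
  have h := hX.indep _ (fun k => A (e.symm k)) (fun k => hA _) (fun k => hμ _)
    (fun i j hij => hd (e.symm.injective.ne hij))
  have := h.precomp e.injective
  simpa using this

lemma lintegral_expNeg_tsum_sum_indicator [IsProbabilityMeasure Pr] (hX : IsPoissonProcess Pr μ X)
    {ι : Type*} [Fintype ι] {A : ι → Set E}
    (hA : ∀ k, MeasurableSet (A k)) (hμ : ∀ k, μ (A k) < ∞)
    (hd : Pairwise (Function.onFun Disjoint A)) {a : ι → ℝ≥0∞} (ha : ∀ k, a k ≠ ∞) :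
    ∫⁻ ω, expNeg (∑' i, ∑ k, a k * (A k).indicator 1 (X i ω)) ∂Pr
      = expNeg (∫⁻ x, (1 - expNeg (∑ k, a k * (A k).indicator 1 x)) ∂μ) := by
  have h1 : ∀ ω, expNeg (∑' i, ∑ k, a k * (A k).indicator 1 (X i ω))
      = ∏ k, expNeg (a k * (count X (A k) ω : ℕ∞)) := by
    intro ω
    rw [Summable.tsum_finsetSum fun _ _ => ENNReal.summable, expNeg_sum]
    simp_rw [ENNReal.tsum_mul_left, toENNReal_count]
  have h2 : ∀ x, 1 - expNeg (∑ k, a k * (A k).indicator 1 x)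
      = ∑ k, (1 - expNeg (a k)) * (A k).indicator 1 x := by
    intro x
    by_cases hx : ∃ k, x ∈ A k
    · obtain ⟨k, hk⟩ := hx
      have hj : ∀ j, j ≠ k → x ∉ A j := fun j hj hxj =>
        Set.disjoint_left.1 (hd hj) hxj hk
      rw [Finset.sum_eq_single k (fun j _ hjk => by simp [hj j hjk]) (by simp),
        Finset.sum_eq_single k (fun j _ hjk => by simp [hj j hjk]) (by simp)]
      simp [hk]
    · push Not at hx
      simp [hx]
  have hm : ∀ k, Measurable (count X (A k)) := fun k => measurable_count hX.measurable (hA k)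
  simp_rw [h1, h2]
  have hi := (hX.iIndepFun_count hA hμ hd).comp (fun k (c : ℕ∞) => expNeg (a k * (c : ℝ≥0∞)))
    (fun k => .of_discrete)
  have := lintegral_prod_eq_prod_lintegral_of_indepFun Finset.univ _ hi
    (fun k => (Measurable.of_discrete.comp (hm k)))
  refine this.trans ?_
  rw [lintegral_finsetSum _ (fun k _ => (measurable_one.indicator (hA k)).const_mul _), expNeg_sum]
  refine Finset.prod_congr rfl fun k _ => ?_
  rw [lintegral_const_mul _ (measurable_one.indicator (hA k)), lintegral_indicator_one (hA k)]
  exact hX.lintegral_expNeg_count (hA k) (hμ k) (ha k)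

lemma lintegral_expNeg_tsum_simpleFunc [IsProbabilityMeasure Pr] (hX : IsPoissonProcess Pr μ X)
    (g : SimpleFunc E ℝ≥0∞) (hg : ∀ x, g x ≠ ∞) (hμ : μ (Function.support g) < ∞) :
    ∫⁻ ω, expNeg (∑' i, g (X i ω)) ∂Pr = expNeg (∫⁻ x, (1 - expNeg (g x)) ∂μ) := by
  classical
  let S := g.range.filter (· ≠ 0)
  have h : ∀ x, g x = ∑ k : S, (k : ℝ≥0∞) * (g ⁻¹' {(k : ℝ≥0∞)}).indicator 1 x := by
    intro x
    by_cases hx : g x = 0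
    · rw [hx, Finset.sum_eq_zero]
      rintro ⟨k, hk⟩ _
      have : k ≠ 0 := (Finset.mem_filter.1 hk).2
      simp [hx, this.symm]
    · have hm : g x ∈ S := Finset.mem_filter.2 ⟨g.mem_range_self x, hx⟩
      rw [Finset.sum_eq_single ⟨g x, hm⟩]
      · simp
      · rintro ⟨k, hk⟩ _ hne
        have : g x ≠ k := fun h => hne (by simp [h])
        simp [this]
      · simp
  simp_rw [h]
  refine hX.lintegral_expNeg_tsum_sum_indicator (A := fun k : S => g ⁻¹' {(k : ℝ≥0∞)})
    (fun k => g.measurableSet_fiber _) (fun k => ?_) (fun i j hij => ?_) (fun k => ?_)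
  · refine (measure_mono fun x hx => ?_).trans_lt hμ
    have h0 := (Finset.mem_filter.1 k.2).2
    simp only [Set.mem_preimage, Set.mem_singleton_iff] at hx
    simpa [hx] using h0
  · refine Set.disjoint_left.2 fun x hi hj => hij (Subtype.ext ?_)
    simp only [Set.mem_preimage, Set.mem_singleton_iff] at hi hj
    rw [← hi, ← hj]
  · obtain ⟨x, hx⟩ := SimpleFunc.mem_range.1 (Finset.mem_filter.1 k.2).1
    rw [← hx]
    exact hg x

/-- Laplace functional of a Poisson point process. -/
lemma lintegral_expNeg_tsum [IsProbabilityMeasure Pr] [SigmaFinite μ]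
    (hX : IsPoissonProcess Pr μ X) {g : E → ℝ≥0∞} (hg : Measurable g) :
    ∫⁻ ω, expNeg (∑' i, g (X i ω)) ∂Pr = expNeg (∫⁻ x, (1 - expNeg (g x)) ∂μ) := by
  let G : ℕ → SimpleFunc E ℝ≥0∞ := fun n =>
    (SimpleFunc.eapprox g n).restrict (spanningSets μ n)
  have hG : ∀ n x, G n x = (spanningSets μ n).indicator (SimpleFunc.eapprox g n) x := fun n x =>
    SimpleFunc.restrict_apply _ (measurableSet_spanningSets μ n) x
  have hmono : ∀ x, Monotone fun n => G n x := by
    intro x m n hmn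
    simp only [hG]
    refine (Set.indicator_le_indicator_of_subset (monotone_spanningSets μ hmn)
      (fun _ => zero_le) x).trans ?_
    exact Set.indicator_le_indicator (SimpleFunc.monotone_eapprox g hmn x)
  have hlim : ∀ x, Tendsto (fun n => G n x) atTop (𝓝 (g x)) := by
    intro x
    have h1 : Tendsto (fun n => SimpleFunc.eapprox g n x) atTop (𝓝 (g x)) := by
      rw [← SimpleFunc.iSup_eapprox_apply hg x]
      exact tendsto_atTop_iSup fun m n h => SimpleFunc.monotone_eapprox g h x
    refine h1.congr' ?_
    obtain ⟨n, hn⟩ := Set.mem_iUnion.1 ((iUnion_spanningSets μ).symm ▸ Set.mem_univ x)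
    filter_upwards [eventually_ge_atTop n] with m hm
    rw [hG, Set.indicator_of_mem (monotone_spanningSets μ hm hn)]
  have hn : ∀ n, ∫⁻ ω, expNeg (∑' i, G n (X i ω)) ∂Pr
      = expNeg (∫⁻ x, (1 - expNeg (G n x)) ∂μ) := by
    intro n
    refine hX.lintegral_expNeg_tsum_simpleFunc (G n) (fun x => ?_) ?_
    · rw [hG]
      refine ((Set.indicator_le_self _ _ x).trans_lt (SimpleFunc.eapprox_lt_top g n x)).ne
    · refine (measure_mono fun x hx => ?_).trans_lt (measure_spanningSets_lt_top μ n)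
      by_contra h
      exact hx (by rw [hG, Set.indicator_of_notMem h])
  have hL : Tendsto (fun n => ∫⁻ ω, expNeg (∑' i, G n (X i ω)) ∂Pr) atTop
      (𝓝 (∫⁻ ω, expNeg (∑' i, g (X i ω)) ∂Pr)) := by
    refine tendsto_lintegral_of_dominated_convergence (fun _ => 1) (fun n => ?_)
      (fun n => ae_of_all _ fun ω => expNeg_le_one _) (by simp) (ae_of_all _ fun ω => ?_)
    · exact measurable_expNeg.comp
        (Measurable.tsum fun i => (G n).measurable.comp (hX.measurable i))
    · refine (continuous_expNeg.tendsto _).comp ?_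
      simp_rw [← MeasureTheory.lintegral_count]
      exact lintegral_tendsto_of_tendsto_of_monotone (fun n => Measurable.of_discrete.aemeasurable)
        (ae_of_all _ fun i => hmono _) (ae_of_all _ fun i => hlim _)
  have hR : Tendsto (fun n => expNeg (∫⁻ x, (1 - expNeg (G n x)) ∂μ)) atTop
      (𝓝 (expNeg (∫⁻ x, (1 - expNeg (g x)) ∂μ))) := by
    refine (continuous_expNeg.tendsto _).comp ?_
    refine lintegral_tendsto_of_tendsto_of_monotone
      (fun n => (measurable_const.sub (measurable_expNeg.comp (G n).measurable)).aemeasurable)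
      (ae_of_all _ fun x m n h => tsub_le_tsub_left (antitone_expNeg (hmono x h)) _)
      (ae_of_all _ fun x => ?_)
    exact ENNReal.Tendsto.sub tendsto_const_nhds ((continuous_expNeg.tendsto _).comp (hlim x))
      (Or.inl ENNReal.one_ne_top)
  exact tendsto_nhds_unique hL ((tendsto_congr hn).2 hR)

end IsPoissonProcess
end Poisson

/-! ### The exponential distribution -/

lemma lintegral_expMeasure_one {F : ℝ → ℝ≥0∞} (hF : Measurable F) :
    ∫⁻ x, F x ∂(expMeasure 1) = ∫⁻ x in Set.Ioi 0, ENNReal.ofReal (Real.exp (-x)) * F x := by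
  have h : expMeasure 1 = (volume : Measure ℝ).withDensity (exponentialPDF 1) := rfl
  have hm : Measurable (exponentialPDF 1) := (measurable_exponentialPDFReal 1).ennreal_ofReal
  rw [h, lintegral_withDensity_eq_lintegral_mul _ hm hF,
    ← setLIntegral_congr Ioi_ae_eq_Ici.symm, ← lintegral_indicator measurableSet_Ici]
  refine lintegral_congr fun x => ?_
  by_cases hx : 0 ≤ x
  · simp [exponentialPDF_eq, hx]
  · simp [exponentialPDF_eq, hx]

lemma lintegral_Ioi_ofReal_exp_neg_mul {b : ℝ} (hb : 0 < b) (c : ℝ) :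
    ∫⁻ x in Set.Ioi c, ENNReal.ofReal (Real.exp (-b * x))
      = ENNReal.ofReal (Real.exp (-b * c) / b) := by
  have hi := integral_exp_mul_Ioi (neg_lt_zero.2 hb) c
  rw [← ofReal_integral_eq_lintegral_ofReal (integrableOn_exp_mul_Ioi (neg_lt_zero.2 hb) c)
    (ae_of_all _ fun x => Real.exp_nonneg _), hi]
  congr 1
  field_simp

lemma lintegral_expNeg_expMeasure_one {c : ℝ} (hc : 0 ≤ c) :
    ∫⁻ x, expNeg (ENNReal.ofReal (x * c)) ∂(expMeasure 1) = ENNReal.ofReal (1 / (1 + c)) := by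
  rw [lintegral_expMeasure_one (by fun_prop)]
  have := lintegral_Ioi_ofReal_exp_neg_mul (b := 1 + c) (by positivity) 0
  simp only [mul_zero, Real.exp_zero] at this
  rw [← this]
  refine setLIntegral_congr_fun measurableSet_Ioi fun x hx => ?_
  have hx : 0 < x := hx
  rw [expNeg_ofReal (by positivity), ← ENNReal.ofReal_mul (Real.exp_nonneg _), ← Real.exp_add]
  ring_nf

lemma lintegral_ofReal_expMeasure_one :
    ∫⁻ x, ENNReal.ofReal x ∂(expMeasure 1) = 1 := by
  rw [lintegral_expMeasure_one (by fun_prop)]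
  have h := Real.integral_rpow_mul_exp_neg_mul_Ioi (a := 2) (r := 1) (by norm_num) one_pos
  have h2 : Real.Gamma 2 = 1 := by simp
  rw [h2] at h
  have hi : Integrable (fun t : ℝ => t ^ ((2 : ℝ) - 1) * Real.exp (-(1 * t)))
      (volume.restrict (Set.Ioi 0)) := Integrable.of_integral_ne_zero (by rw [h]; simp)
  have := ofReal_integral_eq_lintegral_ofReal hi (by
    filter_upwards [ae_restrict_mem measurableSet_Ioi] with x hx
    have hx : 0 < x := hx
    positivity)
  rw [h] at this
  simp only [ENNReal.ofReal_one, div_one, Real.one_rpow, mul_one] at this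
  rw [this]
  refine setLIntegral_congr_fun measurableSet_Ioi fun x hx => ?_
  have hx : 0 < x := hx
  rw [← ENNReal.ofReal_mul (Real.exp_nonneg _), mul_comm]
  norm_num

lemma expMeasure_one_ofReal_ge (z : ℝ≥0∞) :
    expMeasure 1 {x | z ≤ ENNReal.ofReal x ∧ 0 < x} = expNeg z := by
  have hS : MeasurableSet {x : ℝ | z ≤ ENNReal.ofReal x ∧ 0 < x} :=
    (measurableSet_le measurable_const ENNReal.measurable_ofReal).inter measurableSet_Ioi
  induction z with
  | top => simp
  | coe z =>
    rw [← lintegral_indicator_one hS, lintegral_expMeasure_one (measurable_one.indicator hS)]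
    have : ∀ x ∈ Set.Ioi (0 : ℝ), ENNReal.ofReal (Real.exp (-x)) *
        ({x : ℝ | (z : ℝ≥0∞) ≤ ENNReal.ofReal x ∧ 0 < x}).indicator 1 x
        = (Set.Ici (z : ℝ)).indicator (fun x => ENNReal.ofReal (Real.exp (-x))) x := by
      intro x hx
      have hx : 0 < x := hx
      have : (z : ℝ≥0∞) ≤ ENNReal.ofReal x ↔ (z : ℝ) ≤ x := by
        rw [← ENNReal.ofReal_coe_nnreal, ENNReal.ofReal_le_ofReal_iff hx.le]
      by_cases h : (z : ℝ) ≤ x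
      · simp [this, h, hx]
      · simp [this, h]
    rw [setLIntegral_congr_fun measurableSet_Ioi this, setLIntegral_indicator measurableSet_Ici,
      expNeg_of_ne_top ENNReal.coe_ne_top]
    have h2 : (Set.Ici (z : ℝ) ∩ Set.Ioi 0 : Set ℝ) =ᵐ[volume] Set.Ioi (z : ℝ) := by
      have : (Set.Ici (z : ℝ) ∩ Set.Ioi 0 : Set ℝ) =ᵐ[volume]
          (Set.Ioi (z : ℝ) ∩ Set.Ioi 0 : Set ℝ) :=
        Ioi_ae_eq_Ici.symm.inter (ae_eq_refl _)
      refine this.trans (Filter.EventuallyEq.of_eq ?_)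
      ext x
      simp
    rw [setLIntegral_congr h2]
    simpa using lintegral_Ioi_ofReal_exp_neg_mul one_pos (z : ℝ)

/-! ### The spatial integral -/

lemma lintegral_exp_neg_mul_norm_rpow {α t : ℝ} (hα : 2 < α) (ht : 0 < t) :
    ∫⁻ x : Plane, ENNReal.ofReal (Real.exp (-t * ‖x‖ ^ α))
      = ENNReal.ofReal (2 * Real.pi * (t ^ (-(2 / α)) * (1 / α) * Real.Gamma (2 / α))) := by
  have hα0 : 0 < α := by linarith
  have h1 : ∀ y : ℝ, y ^ (Module.finrank ℝ Plane - 1) • Real.exp (-t * y ^ α)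
      = y ^ (1 : ℝ) * Real.exp (-t * y ^ α) := by
    intro y; simp
  have hint : Integrable (fun x : Plane => Real.exp (-t * ‖x‖ ^ α)) := by
    have := integrable_fun_norm_addHaar (volume : Measure Plane)
      (f := fun y => Real.exp (-t * y ^ α))
    refine this.2 ?_
    simp_rw [h1]
    exact integrableOn_rpow_mul_exp_neg_mul_rpow (by norm_num) hα0 ht
  rw [← ofReal_integral_eq_lintegral_ofReal hint (ae_of_all _ fun x => Real.exp_nonneg _)]
  have := integral_fun_norm_addHaar (volume : Measure Plane) (fun y => Real.exp (-t * y ^ α))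
  simp_rw [h1] at this
  rw [this, integral_rpow_mul_exp_neg_mul_rpow hα0 (by norm_num) ht]
  have hb : volume.real (Metric.ball (0 : Plane) 1) = Real.pi := by
    rw [Measure.real, EuclideanSpace.volume_ball_fin_two]
    simp [Real.pi_pos.le]
  rw [hb]
  congr 1
  norm_num
  ring_nf

lemma lintegral_inv_add_norm_rpow {α K : ℝ} (hα : 2 < α) (hK : 0 < K) :
    ∫⁻ x : Plane, ENNReal.ofReal (1 / (K + ‖x‖ ^ α))
      = ENNReal.ofReal (2 * Real.pi ^ 2 / α * csc (2 * Real.pi / α) * K ^ (2 / α - 1)) := by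
  have hα0 : 0 < α := by linarith
  have hδ : 0 < 1 - 2 / α := by rw [sub_pos, div_lt_one hα0]; exact hα
  have h1 : ∀ x : Plane, ENNReal.ofReal (1 / (K + ‖x‖ ^ α))
      = ∫⁻ t in Set.Ioi (0 : ℝ), ENNReal.ofReal (Real.exp (-(K + ‖x‖ ^ α) * t)) := by
    intro x
    have hpos : 0 < K + ‖x‖ ^ α := add_pos_of_pos_of_nonneg hK (by positivity)
    rw [lintegral_Ioi_ofReal_exp_neg_mul hpos]
    simp
  simp_rw [h1]
  rw [lintegral_lintegral_swap (by
    refine Measurable.aemeasurable ?_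
    unfold Function.uncurry
    fun_prop)]
  have h2 : ∀ t ∈ Set.Ioi (0 : ℝ),
      ∫⁻ x : Plane, ENNReal.ofReal (Real.exp (-(K + ‖x‖ ^ α) * t))
      = ENNReal.ofReal (2 * Real.pi * (1 / α) * Real.Gamma (2 / α) *
        (t ^ ((1 - 2 / α) - 1) * Real.exp (-(K * t)))) := by
    intro t ht
    have ht : 0 < t := ht
    have : ∀ x : Plane, ENNReal.ofReal (Real.exp (-(K + ‖x‖ ^ α) * t))
        = ENNReal.ofReal (Real.exp (-(K * t))) * ENNReal.ofReal (Real.exp (-t * ‖x‖ ^ α)) := by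
      intro x
      rw [← ENNReal.ofReal_mul (Real.exp_nonneg _), ← Real.exp_add]
      ring_nf
    simp_rw [this]
    rw [lintegral_const_mul _ (by fun_prop), lintegral_exp_neg_mul_norm_rpow hα ht,
      ← ENNReal.ofReal_mul (Real.exp_nonneg _)]
    ring_nf
  rw [setLIntegral_congr_fun measurableSet_Ioi h2]
  have hI := Real.integral_rpow_mul_exp_neg_mul_Ioi hδ hK
  have hΓ : 0 < Real.Gamma (1 - 2 / α) := Real.Gamma_pos_of_pos hδ
  have hΓ' : 0 < Real.Gamma (2 / α) := Real.Gamma_pos_of_pos (by positivity)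
  have hi : Integrable (fun t : ℝ => t ^ ((1 - 2 / α) - 1) * Real.exp (-(K * t)))
      (volume.restrict (Set.Ioi 0)) := Integrable.of_integral_ne_zero (by rw [hI]; positivity)
  rw [← ofReal_integral_eq_lintegral_ofReal (hi.const_mul _) (by
    filter_upwards [ae_restrict_mem measurableSet_Ioi] with x hx
    have hx : 0 < x := hx
    have := Real.pi_pos
    positivity), integral_const_mul, hI]
  congr 1
  have hrefl := Real.Gamma_mul_Gamma_one_sub (2 / α)
  have hKp : (1 / K) ^ (1 - 2 / α) = K ^ (2 / α - 1) := by
    rw [one_div, Real.inv_rpow hK.le, ← Real.rpow_neg hK.le, neg_sub]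
  rw [hKp, csc]
  calc _ = 2 * Real.pi * (1 / α) * (Real.Gamma (2 / α) * Real.Gamma (1 - 2 / α)) *
        K ^ (2 / α - 1) := by ring
    _ = _ := by rw [hrefl]; ring_nf

/-! ### The temporal integral -/

lemma hasDerivAt_antideriv {a δ t : ℝ} (hδ : 0 < δ) (ha : 0 < a) (ht : 0 < 1 + a * t) :
    HasDerivAt (fun v => (1 + a * v) ^ δ * (δ * a * v - 1) / (a * (δ * (δ + 1))))
      (a * t * (1 + a * t) ^ (δ - 1)) t := by
  have h1 : HasDerivAt (fun v => 1 + a * v) a t := by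
    simpa using ((hasDerivAt_id t).const_mul a).const_add 1
  have h2 : HasDerivAt (fun v => δ * a * v - 1) (δ * a) t := by
    simpa using ((hasDerivAt_id t).const_mul (δ * a)).sub_const 1
  have h3 := ((h1.rpow_const (p := δ) (Or.inl ht.ne')).mul h2).div_const (a * (δ * (δ + 1)))
  refine h3.congr_deriv ?_
  have : (1 + a * t) ^ δ = (1 + a * t) ^ (δ - 1) * (1 + a * t) := by
    rw [← Real.rpow_add_one ht.ne', sub_add_cancel]
  rw [this]
  field_simp
  ring

lemma integral_mul_rpow {a δ : ℝ} (hδ : 0 < δ) (ha : 0 < a) :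
    ∫ v in (0 : ℝ)..1, a * v * (1 + a * v) ^ (δ - 1)
      = ((1 + a) ^ δ * (δ * a - 1) + 1) / (a * (δ * (δ + 1))) := by
  have hpos : ∀ v ∈ Set.uIcc (0 : ℝ) 1, 0 < 1 + a * v := by
    intro v hv
    rw [Set.uIcc_of_le zero_le_one] at hv
    nlinarith [mul_nonneg ha.le hv.1]
  rw [intervalIntegral.integral_eq_sub_of_hasDerivAt
    (fun v hv => hasDerivAt_antideriv hδ ha (hpos v hv))]
  · simp
    ring
  · refine ContinuousOn.intervalIntegrable ?_
    refine (by fun_prop : ContinuousOn (fun v : ℝ => a * v) _).mul ?_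
    exact ContinuousOn.rpow_const (by fun_prop) fun v hv => Or.inl (hpos v hv).ne'

lemma lintegral_tent {T : ℝ} (hT : 0 < T) {G : ℝ → ℝ} (hG : ContinuousOn G (Set.Icc 0 1))
    (hG0 : G 0 = 0) (hpos : ∀ v ∈ Set.Icc (0 : ℝ) 1, 0 ≤ G v) :
    ∫⁻ t : ℝ, ENNReal.ofReal (G (max 0 (1 - |t| / T)))
      = ENNReal.ofReal (2 * T * ∫ v in (0 : ℝ)..1, G v) := by
  have hmem : ∀ t : ℝ, 0 ≤ t → max 0 (1 - t / T) ∈ Set.Icc (0 : ℝ) 1 := by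
    intro t ht
    refine ⟨le_max_left _ _, max_le zero_le_one ?_⟩
    have := div_nonneg ht hT.le
    linarith
  have hcont : Continuous fun t : ℝ => G (max 0 (1 - |t| / T)) :=
    hG.comp_continuous (by fun_prop) fun t => hmem _ (abs_nonneg t)
  have hsupp : HasCompactSupport fun t : ℝ => G (max 0 (1 - |t| / T)) := by
    refine HasCompactSupport.intro (isCompact_Icc (a := -T) (b := T)) fun t ht => ?_
    have : T < |t| := by
      by_contra h
      exact ht (abs_le.1 (not_lt.1 h))
    have : 1 < |t| / T := (one_lt_div hT).2 this
    rw [max_eq_left (by linarith), hG0]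
  rw [← ofReal_integral_eq_lintegral_ofReal (hcont.integrable_of_hasCompactSupport hsupp)
    (ae_of_all _ fun t => hpos _ (hmem _ (abs_nonneg t)))]
  congr 1
  rw [integral_comp_abs (f := fun t => G (max 0 (1 - t / T)))]
  have h1 : ∫ t in Set.Ioi (0 : ℝ), G (max 0 (1 - t / T))
      = ∫ t in Set.Ioc (0 : ℝ) T, G (max 0 (1 - t / T)) := by
    refine (setIntegral_eq_of_subset_of_forall_sdiff_eq_zero measurableSet_Ioi
      Set.Ioc_subset_Ioi_self fun t ht => ?_)
    have hTt : T < t := by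
      by_contra h
      exact ht.2 ⟨ht.1, not_lt.1 h⟩
    have : 1 < t / T := (one_lt_div hT).2 hTt
    rw [max_eq_left (by linarith), hG0]
  rw [h1, ← intervalIntegral.integral_of_le hT.le]
  have h2 : ∫ t in (0 : ℝ)..T, G (max 0 (1 - t / T)) = ∫ t in (0 : ℝ)..T, G (1 - t / T) := by
    refine intervalIntegral.integral_congr fun t ht => ?_
    rw [Set.uIcc_of_le hT.le] at ht
    have : t / T ≤ 1 := (div_le_one hT).2 ht.2
    exact congrArg G (max_eq_right (by linarith))
  rw [h2, intervalIntegral.integral_comp_sub_div G hT.ne' 1, div_self hT.ne']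
  simp [mul_assoc]

/-! ### The space-time integral -/

lemma lintegral_timeSpace {α T a : ℝ} (hα : 2 < α) (hT : 0 < T) (ha : 0 < a) :
    ∫⁻ z : TimeSpace, ENNReal.ofReal
        (a * max 0 (1 - |z.2| / T) / (1 + a * max 0 (1 - |z.2| / T) + ‖z.1‖ ^ α))
      = ENNReal.ofReal (2 * Real.pi ^ 2 * T * csc (2 * Real.pi / α) *
        (((1 + a) ^ (2 / α) * (2 * a - α) + α) / (a * (2 + α)))) := by
  have hα0 : 0 < α := by linarith
  have hcsc : 0 ≤ csc (2 * Real.pi / α) := by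
    refine inv_nonneg.2 (Real.sin_nonneg_of_nonneg_of_le_pi (by positivity) ?_)
    rw [div_le_iff₀ hα0, mul_comm]
    exact mul_le_mul_of_nonneg_left hα.le Real.pi_pos.le
  rw [Measure.volume_eq_prod, lintegral_prod_symm _ (by fun_prop)]
  have h1 : ∀ t : ℝ, ∫⁻ x : Plane, ENNReal.ofReal
        (a * max 0 (1 - |t| / T) / (1 + a * max 0 (1 - |t| / T) + ‖x‖ ^ α))
      = ENNReal.ofReal ((fun v => 2 * Real.pi ^ 2 / α * csc (2 * Real.pi / α) *
        (a * v * (1 + a * v) ^ (2 / α - 1))) (max 0 (1 - |t| / T))) := by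
    intro t
    have hv : 0 ≤ max 0 (1 - |t| / T) := le_max_left _ _
    generalize max 0 (1 - |t| / T) = v at hv
    have : ∀ x : Plane, ENNReal.ofReal (a * v / (1 + a * v + ‖x‖ ^ α))
        = ENNReal.ofReal (a * v) * ENNReal.ofReal (1 / (1 + a * v + ‖x‖ ^ α)) := by
      intro x
      rw [← ENNReal.ofReal_mul (by positivity), mul_one_div]
    simp_rw [this]
    rw [lintegral_const_mul _ (by fun_prop), lintegral_inv_add_norm_rpow hα (by positivity),
      ← ENNReal.ofReal_mul (by positivity)]
    ring_nf
  simp_rw [h1]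
  have hpos : ∀ v ∈ Set.Icc (0 : ℝ) 1, 0 < 1 + a * v := fun v hv => by
    nlinarith [mul_nonneg ha.le hv.1]
  rw [lintegral_tent hT (G := fun v => 2 * Real.pi ^ 2 / α * csc (2 * Real.pi / α) *
    (a * v * (1 + a * v) ^ (2 / α - 1))), intervalIntegral.integral_const_mul,
    integral_mul_rpow (by positivity) ha]
  · congr 1
    field_simp
  · refine ContinuousOn.mul continuousOn_const (ContinuousOn.mul (by fun_prop) ?_)
    exact ContinuousOn.rpow_const (by fun_prop) fun v hv => Or.inl (hpos v hv).ne'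
  · simp
  · intro v hv
    have := hpos v hv
    have := hv.1
    positivity

/-! ### Independent marks -/

section Marks

variable {Ω E M M' : Type*} [MeasurableSpace Ω] [MeasurableSpace E] [MeasurableSpace M]
  [MeasurableSpace M'] {Pr : Measure Ω}

lemma iIndepFun_prodMk {ι : Type*} {m : ι → Ω → M} {m' : ι → Ω → M'} (hm : ∀ i, Measurable (m i))
    (hm' : ∀ i, Measurable (m' i)) (hi : iIndepFun m Pr) (hi' : iIndepFun m' Pr)
    (h : IndepFun (fun ω i => m i ω) (fun ω i => m' i ω) Pr) :
    iIndepFun (fun i ω => (m i ω, m' i ω)) Pr := by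
  refine iIndepSets.iIndep (fun i => ((hm i).prodMk (hm' i)).comap_le)
    (fun i => Set.preimage (fun ω => (m i ω, m' i ω)) ''
      Set.image2 (· ×ˢ ·) {s | MeasurableSet s} {t | MeasurableSet t})
    (fun i => isPiSystem_prod.comap _) (fun i => ?_) ?_
  · rw [← MeasurableSpace.comap_generateFrom, generateFrom_prod]
  · rw [iIndepSets_iff]
    intro S f hf
    have hf' : ∀ i, ∃ s t, MeasurableSet s ∧ MeasurableSet t ∧
        (i ∈ S → f i = m i ⁻¹' s ∩ m' i ⁻¹' t) := by
      intro i
      by_cases hiS : i ∈ S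
      · obtain ⟨_, ⟨s, hs, t, ht, rfl⟩, hst⟩ := hf i hiS
        exact ⟨s, t, hs, ht, fun _ => by rw [← hst]; rfl⟩
      · exact ⟨∅, ∅, .empty, .empty, fun h => absurd h hiS⟩
    choose s t hs ht hst using hf'
    have hA : MeasurableSet {q : ι → M | ∀ i ∈ S, q i ∈ s i} := by
      simp only [Set.ofPred_forall]
      exact Finset.measurableSet_biInter S fun i _ => measurable_pi_apply i (hs i)
    have hB : MeasurableSet {q : ι → M' | ∀ i ∈ S, q i ∈ t i} := by
      simp only [Set.ofPred_forall]
      exact Finset.measurableSet_biInter S fun i _ => measurable_pi_apply i (ht i)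
    have hAB := h.measure_inter_preimage_eq_mul _ _ hA hB
    have h1 : (⋂ i ∈ S, f i) = (fun ω i => m i ω) ⁻¹' {q : ι → M | ∀ i ∈ S, q i ∈ s i} ∩
        (fun ω i => m' i ω) ⁻¹' {q : ι → M' | ∀ i ∈ S, q i ∈ t i} := by
      ext ω
      simp only [Set.mem_iInter, Set.mem_inter_iff, Set.mem_preimage, Set.mem_ofPred_eq,
        ← forall_and]
      refine forall_congr' fun i => forall_congr' fun hi => ?_
      rw [hst i hi]; rfl
    have h2 : (fun ω i => m i ω) ⁻¹' {q : ι → M | ∀ i ∈ S, q i ∈ s i} = ⋂ i ∈ S, m i ⁻¹' s i := by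
      ext ω; simp
    have h3 : (fun ω i => m' i ω) ⁻¹' {q : ι → M' | ∀ i ∈ S, q i ∈ t i}
        = ⋂ i ∈ S, m' i ⁻¹' t i := by
      ext ω; simp
    rw [h1, hAB, h2, h3, hi.measure_inter_preimage_eq_mul S (fun i _ => hs i),
      hi'.measure_inter_preimage_eq_mul S (fun i _ => ht i), ← Finset.prod_mul_distrib]
    refine Finset.prod_congr rfl fun i hiS => ?_
    rw [hst i hiS]
    have hi2 : IndepFun (m i) (m' i) Pr :=
      h.comp (measurable_pi_apply i) (measurable_pi_apply i)
    exact (hi2.measure_inter_preimage_eq_mul _ _ (hs i) (ht i)).symm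

variable [IsProbabilityMeasure Pr]

lemma lintegral_prod_marks {Z : ℕ → Ω → E} {m : ℕ → Ω → M} (hZ : ∀ i, Measurable (Z i))
    (hm : ∀ i, Measurable (m i)) (hZm : IndepFun (fun ω i => Z i ω) (fun ω i => m i ω) Pr)
    (hi : iIndepFun m Pr) {ν : Measure M} (hν : ∀ i, Pr.map (m i) = ν)
    {F : E → M → ℝ≥0∞} (hF : Measurable (Function.uncurry F)) (n : ℕ) :
    ∫⁻ ω, ∏ i ∈ Finset.range n, F (Z i ω) (m i ω) ∂Pr
      = ∫⁻ ω, ∏ i ∈ Finset.range n, ∫⁻ c, F (Z i ω) c ∂ν ∂Pr := by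
  have hZ' : Measurable fun ω i => Z i ω := measurable_pi_lambda _ hZ
  have hm' : Measurable fun ω i => m i ω := measurable_pi_lambda _ hm
  have hν' : IsProbabilityMeasure ν := hν 0 ▸ Measure.isProbabilityMeasure_map (hm 0).aemeasurable
  have hΦ : Measurable fun q : (ℕ → E) × (ℕ → M) =>
      ∏ i ∈ Finset.range n, F (q.1 i) (q.2 i) :=
    Finset.measurable_prod _ fun i _ => hF.comp (by fun_prop :
      Measurable fun q : (ℕ → E) × (ℕ → M) => (q.1 i, q.2 i))
  have hlaw := (indepFun_iff_map_prod_eq_prod_map_map hZ'.aemeasurable hm'.aemeasurable).1 hZm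
  have : IsProbabilityMeasure (Pr.map fun ω i => m i ω) :=
    Measure.isProbabilityMeasure_map hm'.aemeasurable
  have h1 := lintegral_map (μ := Pr) hΦ (hZ'.prodMk hm')
  rw [hlaw, lintegral_prod _ hΦ.aemeasurable, lintegral_map hΦ.lintegral_prod_right' hZ'] at h1
  rw [← h1]
  refine lintegral_congr fun ω => ?_
  rw [lintegral_map (f := fun y => ∏ i ∈ Finset.range n, F (Z i ω) (y i))
    (hΦ.comp (measurable_prodMk_left (x := fun i => Z i ω))) hm']
  have hFm : ∀ i, Measurable (F (Z i ω)) := fun i => hF.of_uncurry_left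
  have := lintegral_prod_eq_prod_lintegral_of_indepFun (Finset.range n) _
    (hi.comp (fun i => F (Z i ω)) hFm) (fun i => (hFm i).comp (hm i))
  refine this.trans (Finset.prod_congr rfl fun i _ => ?_)
  rw [← hν i, lintegral_map (hFm i) (hm i)]
  rfl

/-- Averaging over independent marks in the Laplace functional. -/
lemma lintegral_expNeg_tsum_marks {Z : ℕ → Ω → E} {m : ℕ → Ω → M} (hZ : ∀ i, Measurable (Z i))
    (hm : ∀ i, Measurable (m i)) (hZm : IndepFun (fun ω i => Z i ω) (fun ω i => m i ω) Pr)
    (hi : iIndepFun m Pr) {ν : Measure M} (hν : ∀ i, Pr.map (m i) = ν)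
    {G : E → M → ℝ≥0∞} (hG : Measurable (Function.uncurry G)) :
    ∫⁻ ω, expNeg (∑' i, G (Z i ω) (m i ω)) ∂Pr
      = ∫⁻ ω, expNeg (∑' i, negLog (∫⁻ c, expNeg (G (Z i ω) c) ∂ν)) ∂Pr := by
  have hν' : IsProbabilityMeasure ν := hν 0 ▸ Measure.isProbabilityMeasure_map (hm 0).aemeasurable
  have hF : Measurable (Function.uncurry fun x c => expNeg (G x c)) := measurable_expNeg.comp hG
  have hf : Measurable fun x => ∫⁻ c, expNeg (G x c) ∂ν := hF.lintegral_prod_right'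
  have hle : ∀ x, ∫⁻ c, expNeg (G x c) ∂ν ≤ 1 := fun x =>
    (lintegral_mono fun c => expNeg_le_one _).trans (by simp)
  have hprod : ∀ (a : ℕ → ℝ≥0∞) (n : ℕ), (∀ i, a i ≤ 1) → ∏ i ∈ Finset.range n, a i ≤ 1 :=
    fun a n h => Finset.prod_le_one' fun i _ => h i
  have h1 : Tendsto (fun n => ∫⁻ ω, ∏ i ∈ Finset.range n, expNeg (G (Z i ω) (m i ω)) ∂Pr) atTop
      (𝓝 (∫⁻ ω, expNeg (∑' i, G (Z i ω) (m i ω)) ∂Pr)) := by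
    refine tendsto_lintegral_of_dominated_convergence (fun _ => 1) (fun n => ?_)
      (fun n => ae_of_all _ fun ω => hprod _ _ fun i => expNeg_le_one _) (by simp)
      (ae_of_all _ fun ω => tendsto_prod_expNeg _)
    exact Finset.measurable_prod _ fun i _ => hF.comp ((hZ i).prodMk (hm i))
  have h2 : Tendsto (fun n => ∫⁻ ω, ∏ i ∈ Finset.range n, ∫⁻ c, expNeg (G (Z i ω) c) ∂ν ∂Pr) atTop
      (𝓝 (∫⁻ ω, expNeg (∑' i, negLog (∫⁻ c, expNeg (G (Z i ω) c) ∂ν)) ∂Pr)) := by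
    refine tendsto_lintegral_of_dominated_convergence (fun _ => 1) (fun n => ?_)
      (fun n => ae_of_all _ fun ω => hprod _ _ fun i => hle _) (by simp)
      (ae_of_all _ fun ω => ?_)
    · exact Finset.measurable_prod _ fun i _ => hf.comp (hZ i)
    · simpa only [expNeg_negLog (hle _)] using
        tendsto_prod_expNeg fun i => negLog (∫⁻ c, expNeg (G (Z i ω) c) ∂ν)
  refine tendsto_nhds_unique h1 (h2.congr fun n => ?_)
  exact (lintegral_prod_marks hZ hm hZm hi hν hF n).symm

/-- Laplace functional of an independently marked Poisson point process. -/
lemma IsPoissonProcess.lintegral_expNeg_tsum_marks {μ : Measure E} [SigmaFinite μ]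
    {X : ℕ → Ω → E} (hX : IsPoissonProcess Pr μ X) {m : ℕ → Ω → M}
    (hm : ∀ i, Measurable (m i)) (hXm : IndepFun (fun ω i => X i ω) (fun ω i => m i ω) Pr)
    (hi : iIndepFun m Pr) {ν : Measure M} (hν : ∀ i, Pr.map (m i) = ν)
    {G : E → M → ℝ≥0∞} (hG : Measurable (Function.uncurry G)) :
    ∫⁻ ω, expNeg (∑' i, G (X i ω) (m i ω)) ∂Pr
      = expNeg (∫⁻ x, (1 - ∫⁻ c, expNeg (G x c) ∂ν) ∂μ) := by
  have hν' : IsProbabilityMeasure ν := hν 0 ▸ Measure.isProbabilityMeasure_map (hm 0).aemeasurable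
  have hF : Measurable (Function.uncurry fun x c => expNeg (G x c)) := measurable_expNeg.comp hG
  have hf : Measurable fun x => ∫⁻ c, expNeg (G x c) ∂ν := hF.lintegral_prod_right'
  have hle : ∀ x, ∫⁻ c, expNeg (G x c) ∂ν ≤ 1 := fun x =>
    (lintegral_mono fun c => expNeg_le_one _).trans (by simp)
  rw [AdHoc.lintegral_expNeg_tsum_marks hX.measurable hm hXm hi hν hG,
    hX.lintegral_expNeg_tsum (g := fun x => negLog (∫⁻ c, expNeg (G x c) ∂ν))
      (measurable_negLog.comp hf)]
  simp_rw [expNeg_negLog (hle _)]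

end Marks

/-! ### Energy received from one transmitter -/

/-- Time during `[0, D]` at which a transmission of duration `T` started at `τ` is on. -/
def onTime (T D τ : ℝ) : ℝ≥0∞ := ∫⁻ t in Set.Icc 0 D, phi T t τ

lemma phi_eq_indicator (T t τ : ℝ) : phi T t τ = (Set.Icc τ (τ + T)).indicator 1 t := by
  classical
  simp [phi, Set.indicator_apply]

@[fun_prop] lemma measurable_phi (T : ℝ) : Measurable fun q : ℝ × ℝ => phi T q.1 q.2 := by
  classical
  unfold phi
  exact Measurable.ite ((measurableSet_le measurable_snd measurable_fst).inter
    (measurableSet_le measurable_fst (by fun_prop))) measurable_const measurable_const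

@[fun_prop] lemma measurable_onTime (T D : ℝ) : Measurable (onTime T D) := by
  unfold onTime
  exact (measurable_phi T).lintegral_prod_left'

lemma onTime_eq_volume (T D τ : ℝ) :
    onTime T D τ = volume (Set.Icc τ (τ + T) ∩ Set.Icc 0 D) := by
  simp_rw [onTime, phi_eq_indicator]
  rw [lintegral_indicator_one measurableSet_Icc, Measure.restrict_apply measurableSet_Icc]

lemma lintegral_onTime {T D : ℝ} : ∫⁻ τ, onTime T D τ = ENNReal.ofReal D * ENNReal.ofReal T := by
  unfold onTime
  rw [lintegral_lintegral_swap (by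
    exact ((measurable_phi T).comp measurable_swap).aemeasurable)]
  have : ∀ t, ∫⁻ τ, phi T t τ = ENNReal.ofReal T := by
    intro t
    have : ∀ τ, phi T t τ = (Set.Icc (t - T) t).indicator 1 τ := by
      classical
      intro τ
      simp only [phi, Set.indicator_apply, Set.mem_Icc, tsub_le_iff_right, Pi.one_apply, and_comm]
    simp_rw [this]
    rw [lintegral_indicator_one measurableSet_Icc, Real.volume_Icc]
    congr 1
    ring
  simp_rw [this]
  simp [mul_comm]

lemma inv_mul_onTime {T : ℝ} (hT : 0 < T) (τ : ℝ) :
    (ENNReal.ofReal T)⁻¹ * onTime T T τ = ENNReal.ofReal (max 0 (1 - |τ| / T)) := by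
  rw [onTime_eq_volume, Set.Icc_inter_Icc, Real.volume_Icc, ← ENNReal.ofReal_inv_of_pos hT,
    ← ENNReal.ofReal_mul (by positivity)]
  have h : (τ + T) ⊓ T - τ ⊔ 0 = T - |τ| := by
    rcases le_total 0 τ with h | h
    · rw [inf_of_le_right (by linarith), sup_of_le_left h, abs_of_nonneg h]
    · rw [inf_of_le_left (by linarith), sup_of_le_right h, abs_of_nonpos h]; ring
  rw [h, max_comm, ENNReal.ofReal_max, ENNReal.ofReal_zero, max_eq_left zero_le]
  congr 1
  field_simp

lemma le_onTime {T D τ : ℝ} (h1 : -(T / 2) ≤ τ) (h2 : τ ≤ 0) :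
    ENNReal.ofReal (min D (T / 2)) ≤ onTime T D τ := by
  rw [onTime_eq_volume]
  have : ENNReal.ofReal (min D (T / 2)) = volume (Set.Icc 0 (min D (T / 2))) := by simp
  rw [this]
  refine measure_mono fun t ht => ?_
  have := ht.1
  have := ht.2.trans (min_le_left _ _)
  have := ht.2.trans (min_le_right _ _)
  exact ⟨⟨by linarith, by linarith⟩, ⟨by linarith, by linarith⟩⟩

lemma pathLoss_nonneg (α : ℝ) {r : ℝ} (hr : 0 ≤ r) : 0 ≤ pathLoss α r := by
  unfold pathLoss; positivity

@[fun_prop] lemma measurable_pathLoss (α : ℝ) : Measurable (pathLoss α) := by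
  unfold pathLoss; fun_prop

/-- Energy received during `[0, D]` from a transmitter of unit power with fading `c`. -/
def received (p : Params) (D : ℝ) (z : TimeSpace) (c : ℝ) : ℝ≥0∞ :=
  onTime p.TI D z.2 * ENNReal.ofReal (c * pathLoss p.α ‖z.1‖)

lemma measurable_received (p : Params) (D : ℝ) :
    Measurable (Function.uncurry (received p D)) := by
  unfold received Function.uncurry
  fun_prop

lemma measurable_gain (p : Params) :
    Measurable fun q : ℝ × TimeSpace × ℝ => gain p q.1 q.2.1 q.2.2 := by
  unfold gain
  refine Measurable.mul ?_ (by fun_prop)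
  exact (measurable_phi p.TI).comp (by fun_prop :
    Measurable fun q : ℝ × TimeSpace × ℝ => (q.1, q.2.1.2))

lemma measurable_gain_time (p : Params) (z : TimeSpace) (c : ℝ) :
    Measurable fun t => gain p t z c :=
  (measurable_gain p).comp (measurable_id.prodMk (measurable_const (a := (z, c))))

lemma lintegral_gain (p : Params) (D : ℝ) (z : TimeSpace) (c : ℝ) :
    ∫⁻ t in Set.Icc 0 D, gain p t z c = received p D z c := by
  unfold gain received onTime
  rw [lintegral_mul_const]
  exact (measurable_phi p.TI).comp (measurable_id.prodMk measurable_const)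

lemma lintegral_tsum_gain (p : Params) (D : ℝ) (Q : ℝ≥0∞) (z : ℕ → TimeSpace) (c : ℕ → ℝ) :
    ∫⁻ t in Set.Icc 0 D, Q * ∑' i, gain p t (z i) (c i) = Q * ∑' i, received p D (z i) (c i) := by
  rw [lintegral_const_mul _ (Measurable.tsum fun i => measurable_gain_time p _ _),
    lintegral_tsum fun i => (measurable_gain_time p _ _).aemeasurable]
  simp_rw [lintegral_gain]

lemma lintegral_tsum_ite_gain (p : Params) (D : ℝ) (Q : ℝ≥0∞) (z : ℕ → TimeSpace) (c : ℕ → ℝ)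
    (b : ℕ → Bool) :
    ∫⁻ t in Set.Icc 0 D, Q * ∑' i, (if b i = true then gain p t (z i) (c i) else 0)
      = Q * ∑' i, (if b i = true then received p D (z i) (c i) else 0) := by
  have hm : ∀ i, Measurable fun t => if b i = true then gain p t (z i) (c i) else 0 := by
    intro i
    split_ifs
    exacts [measurable_gain_time p _ _, measurable_const]
  rw [lintegral_const_mul _ (Measurable.tsum hm), lintegral_tsum fun i => (hm i).aemeasurable]
  congr 1
  refine tsum_congr fun i => ?_
  split_ifs
  exacts [lintegral_gain p D _ _, by simp]

lemma lintegral_onTime_mul_pathLoss (p : Params) (D : ℝ) :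
    ∫⁻ z : TimeSpace, onTime p.TI D z.2 * ENNReal.ofReal (pathLoss p.α ‖z.1‖) < ∞ := by
  rw [Measure.volume_eq_prod, lintegral_prod_symm _ (by fun_prop)]
  have h : ∀ t : ℝ, ∫⁻ x : Plane, onTime p.TI D t * ENNReal.ofReal (pathLoss p.α ‖x‖)
      = onTime p.TI D t * ∫⁻ x : Plane, ENNReal.ofReal (pathLoss p.α ‖x‖) := fun t =>
    lintegral_const_mul _ (by fun_prop)
  simp_rw [h]
  rw [lintegral_mul_const _ (by fun_prop), lintegral_onTime]
  have hx := lintegral_inv_add_norm_rpow p.two_lt_α one_pos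
  simp_rw [one_div] at hx
  unfold pathLoss
  rw [hx]
  exact ENNReal.mul_lt_top (ENNReal.mul_lt_top ENNReal.ofReal_lt_top ENNReal.ofReal_lt_top)
    ENNReal.ofReal_lt_top

/-- Probability generating factor of a transmitter whose fading is exponential. -/
lemma one_sub_lintegral_expNeg_received (p : Params) {a : ℝ} (ha : 0 ≤ a) (z : TimeSpace) :
    1 - ∫⁻ c, expNeg (ENNReal.ofReal a * ((ENNReal.ofReal p.TI)⁻¹ * received p p.TI z c))
        ∂(expMeasure 1)
      = ENNReal.ofReal (a * max 0 (1 - |z.2| / p.TI) /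
        (1 + a * max 0 (1 - |z.2| / p.TI) + ‖z.1‖ ^ p.α)) := by
  have hr : 0 ≤ ‖z.1‖ ^ p.α := by positivity
  have hpl := pathLoss_nonneg p.α (norm_nonneg z.1)
  have hv : 0 ≤ max 0 (1 - |z.2| / p.TI) := le_max_left _ _
  have h1 : ∀ c, ENNReal.ofReal a * ((ENNReal.ofReal p.TI)⁻¹ * received p p.TI z c)
      = ENNReal.ofReal (c * (a * max 0 (1 - |z.2| / p.TI) * pathLoss p.α ‖z.1‖)) := by
    intro c
    rw [received, ← mul_assoc, ← mul_assoc, mul_assoc (ENNReal.ofReal a),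
      inv_mul_onTime p.TI_pos, ← ENNReal.ofReal_mul ha, ← ENNReal.ofReal_mul (by positivity)]
    congr 1
    ring
  simp_rw [h1]
  rw [lintegral_expNeg_expMeasure_one (by positivity), ← ENNReal.ofReal_one,
    ← ENNReal.ofReal_sub _ (by positivity)]
  congr 1
  generalize max 0 (1 - |z.2| / p.TI) = v at hv
  unfold pathLoss
  have : 0 < 1 + ‖z.1‖ ^ p.α := by positivity
  have : 0 < 1 + a * v + ‖z.1‖ ^ p.α := by positivity
  have : 0 < 1 + ‖z.1‖ ^ p.α + a * v := by positivity
  field_simp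
  ring

lemma isSigmaFinite_intensity (lam : ℝ) :
    SigmaFinite (ENNReal.ofReal lam • (volume : Measure TimeSpace)) :=
  inferInstanceAs (SigmaFinite (lam.toNNReal • (volume : Measure TimeSpace)))

section Received

variable {Ω : Type*} [MeasurableSpace Ω] {Pr : Measure Ω} [IsProbabilityMeasure Pr]
  {X : ℕ → Ω → TimeSpace} {h : ℕ → Ω → ℝ} {lam : ℝ}

lemma measurable_received_comp (p : Params) (D : ℝ) {z : Ω → TimeSpace} {c : Ω → ℝ}
    (hz : Measurable z) (hc : Measurable c) : Measurable fun ω => received p D (z ω) (c ω) :=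
  (measurable_received p D).comp (hz.prodMk hc)

lemma lintegral_tsum_received_lt_top (hX : IsTimeSpacePPP Pr lam X) (hm : ∀ i, Measurable (h i))
    (hl : ∀ i, Pr.map (h i) = expMeasure 1)
    (hXh : IndepFun (fun ω i => X i ω) (fun ω i => h i ω) Pr) (p : Params) (D : ℝ) :
    ∫⁻ ω, ∑' i, received p D (X i ω) (h i ω) ∂Pr < ∞ := by
  have := isSigmaFinite_intensity lam
  have hX' : IsPoissonProcess Pr _ X := hX
  have hf : Measurable fun z : TimeSpace =>
      onTime p.TI D z.2 * ENNReal.ofReal (pathLoss p.α ‖z.1‖) := by fun_prop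
  rw [lintegral_tsum fun i => (measurable_received_comp p D (hX'.measurable i) (hm i)).aemeasurable]
  have h1 : ∀ i, ∫⁻ ω, received p D (X i ω) (h i ω) ∂Pr = ∫⁻ ω, (fun z : TimeSpace =>
      onTime p.TI D z.2 * ENNReal.ofReal (pathLoss p.α ‖z.1‖)) (X i ω) ∂Pr := by
    intro i
    have h2 : ∀ ω, received p D (X i ω) (h i ω) = (fun z : TimeSpace =>
        onTime p.TI D z.2 * ENNReal.ofReal (pathLoss p.α ‖z.1‖)) (X i ω) *
          ENNReal.ofReal (h i ω) := by
      intro ω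
      rw [received, ENNReal.ofReal_mul' (pathLoss_nonneg _ (norm_nonneg _))]
      ring
    simp_rw [h2]
    have hind : IndepFun (X i) (h i) Pr := hXh.comp (measurable_pi_apply i) (measurable_pi_apply i)
    have := lintegral_mul_eq_lintegral_mul_lintegral_of_indepFun'' (μ := Pr)
      (hf.comp (hX'.measurable i)).aemeasurable
      (ENNReal.measurable_ofReal.comp (hm i)).aemeasurable
      (hind.comp hf ENNReal.measurable_ofReal)
    have he : ∫⁻ ω, ENNReal.ofReal (h i ω) ∂Pr = 1 := by
      rw [← lintegral_ofReal_expMeasure_one, ← hl i,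
        lintegral_map ENNReal.measurable_ofReal (hm i)]
    refine this.trans ?_
    simp only [Function.comp_apply]
    rw [he, mul_one]
  simp_rw [h1]
  rw [hX'.tsum_lintegral hf, lintegral_smul_measure]
  exact ENNReal.mul_lt_top ENNReal.ofReal_lt_top (lintegral_onTime_mul_pathLoss p D)

lemma exists_measure_received_pos (hX : IsTimeSpacePPP Pr lam X) (hlam : 0 < lam)
    (hm : ∀ i, Measurable (h i)) (hl : ∀ i, Pr.map (h i) = expMeasure 1)
    (hXh : IndepFun (fun ω i => X i ω) (fun ω i => h i ω) Pr) (p : Params) {D : ℝ} (hD : 0 < D)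
    (K : ℝ) :
    ∃ i, 0 < Pr {ω | ENNReal.ofReal K ≤ received p D (X i ω) (h i ω)} := by
  have := isSigmaFinite_intensity lam
  have hX' : IsPoissonProcess Pr _ X := hX
  have hTI := p.TI_pos
  set δ := min D (p.TI / 2) with hδ
  have hδ0 : 0 < δ := lt_min hD (by linarith)
  set A : Set TimeSpace := Metric.ball 0 1 ×ˢ Set.Icc (-(p.TI / 2)) 0 with hA
  have hAm : MeasurableSet A := measurableSet_ball.prod measurableSet_Icc
  have hpos : 0 < (ENNReal.ofReal lam • (volume : Measure TimeSpace)) A := by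
    rw [Measure.smul_apply, hA, Measure.volume_eq_prod, Measure.prod_prod, smul_eq_mul]
    refine ENNReal.mul_pos (ENNReal.ofReal_pos.2 hlam).ne' (mul_ne_zero ?_ ?_)
    · exact (Metric.measure_ball_pos volume _ one_pos).ne'
    · rw [Real.volume_Icc]
      exact (ENNReal.ofReal_pos.2 (by linarith)).ne'
  rw [← hX'.sum_map, Measure.sum_apply _ hAm] at hpos
  obtain ⟨i, hi⟩ : ∃ i, Pr.map (X i) A ≠ 0 := by
    by_contra! hc
    simp [hc] at hpos
  rw [Measure.map_apply (hX'.measurable i) hAm] at hi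
  set B : Set ℝ := {x | ENNReal.ofReal (2 * K / δ) ≤ ENNReal.ofReal x ∧ 0 < x} with hB
  have hBm : MeasurableSet B :=
    (measurableSet_le measurable_const ENNReal.measurable_ofReal).inter measurableSet_Ioi
  have hBpos : Pr (h i ⁻¹' B) ≠ 0 := by
    rw [← Measure.map_apply (hm i) hBm, hl i, hB, expMeasure_one_ofReal_ge,
      expNeg_of_ne_top ENNReal.ofReal_ne_top]
    exact (ENNReal.ofReal_pos.2 (Real.exp_pos _)).ne'
  have hind : IndepFun (X i) (h i) Pr := hXh.comp (measurable_pi_apply i) (measurable_pi_apply i)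
  refine ⟨i, lt_of_lt_of_le (pos_iff_ne_zero.2 (mul_ne_zero hi hBpos)) ?_⟩
  rw [← hind.measure_inter_preimage_eq_mul _ _ hAm hBm]
  refine measure_mono fun ω hω => ?_
  obtain ⟨⟨hx, hτ⟩, hc, hc0⟩ := hω
  rw [ENNReal.ofReal_le_ofReal_iff hc0.le] at hc
  have hx1 : ‖(X i ω).1‖ ≤ 1 := (mem_ball_zero_iff.1 hx).le
  have hpl : 1 / 2 ≤ pathLoss p.α ‖(X i ω).1‖ := by
    have h1 : ‖(X i ω).1‖ ^ p.α ≤ 1 :=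
      Real.rpow_le_one (norm_nonneg _) hx1 (by linarith [p.two_lt_α])
    have h0 : 0 ≤ ‖(X i ω).1‖ ^ p.α := by positivity
    rw [pathLoss, ← one_div]
    exact one_div_le_one_div_of_le (by linarith) (by linarith)
  calc ENNReal.ofReal K = ENNReal.ofReal δ * ENNReal.ofReal (2 * K / δ * (1 / 2)) := by
        rw [← ENNReal.ofReal_mul hδ0.le]
        congr 1
        field_simp
    _ ≤ _ := by
        refine mul_le_mul' (le_onTime hτ.1 hτ.2) (ENNReal.ofReal_le_ofReal ?_)
        exact mul_le_mul hc hpl (by norm_num) hc0.le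

end Received

namespace Network

variable {Ω : Type*} {N : Network Ω} {p : Params}

lemma harvested_eq (ω : Ω) : N.harvested p ω
    = ENNReal.ofReal p.P₁ * ∑' i, received p p.TE (N.X i ω) (N.h i ω) :=
  lintegral_tsum_gain p _ _ _ _

lemma I₁_eq (ω : Ω) : N.I₁ p ω = (ENNReal.ofReal p.TI)⁻¹ * (ENNReal.ofReal p.P₁ *
    ∑' i, received p p.TI (N.X i ω) (N.h i ω)) :=
  congrArg _ (lintegral_tsum_gain p _ _ _ _)

/-- The interference `I₁` as a function of the primary network. -/
lemma exists_measurable_I₁ (N : Network Ω) (p : Params) :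
    ∃ F : (ℕ → TimeSpace) × (ℕ → ℝ) × (ℕ → Plane) → ℝ≥0∞,
    Measurable F ∧ ∀ ω,
      N.I₁ p ω = F (fun i => N.X i ω, fun i => N.h i ω, fun i => N.u i ω) := by
  refine ⟨fun q => (ENNReal.ofReal p.TI)⁻¹ * (ENNReal.ofReal p.P₁ *
    ∑' i, received p p.TI (q.1 i) (q.2.1 i)), ?_, fun ω => I₁_eq ω⟩
  refine Measurable.const_mul (Measurable.const_mul (Measurable.tsum fun i => ?_) _) _
  exact measurable_received_comp p p.TI (by fun_prop) (by fun_prop)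

variable [MeasurableSpace Ω] {Pr : Measure Ω}

lemma I₂_eq (ω : Ω) : N.I₂ p Pr ω = (ENNReal.ofReal p.TI)⁻¹ * (N.P₂ p Pr *
    ∑' i, (if N.b i ω = true then received p p.TI (N.Y i ω) (N.g i ω) else 0)) :=
  congrArg _ (lintegral_tsum_ite_gain p _ _ _ _ _)

/-- The interference `I₂` as a function of the secondary network. -/
lemma exists_measurable_I₂ (N : Network Ω) (p : Params) (Pr : Measure Ω) :
    ∃ F : (ℕ → TimeSpace) × (ℕ → ℝ) × (ℕ → Bool) → ℝ≥0∞,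
    Measurable F ∧ ∀ ω,
      N.I₂ p Pr ω = F (fun i => N.Y i ω, fun i => N.g i ω, fun i => N.b i ω) := by
  refine ⟨fun q => (ENNReal.ofReal p.TI)⁻¹ * (N.P₂ p Pr *
    ∑' i, (if q.2.2 i = true then received p p.TI (q.1 i) (q.2.1 i) else 0)), ?_, fun ω => I₂_eq ω⟩
  refine Measurable.const_mul (Measurable.const_mul (Measurable.tsum fun i => ?_) _) _
  refine Measurable.ite ?_ (measurable_received_comp p p.TI (by fun_prop) (by fun_prop))
    measurable_const
  exact (by fun_prop : Measurable fun q : (ℕ → TimeSpace) × (ℕ → ℝ) × (ℕ → Bool) => q.2.2 i)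
    (measurableSet_singleton true)

namespace IsModel

lemma measurable_X (hN : N.IsModel p Pr) (i : ℕ) : Measurable (N.X i) :=
  IsPoissonProcess.measurable (μ := ENNReal.ofReal p.lam₁ • volume) hN.primary i

lemma measurable_Y (hN : N.IsModel p Pr) (i : ℕ) : Measurable (N.Y i) :=
  IsPoissonProcess.measurable (μ := ENNReal.ofReal p.lam₂ • volume) hN.secondary i

lemma indep_X_h (hN : N.IsModel p Pr) :
    IndepFun (fun ω i => N.X i ω) (fun ω i => N.h i ω) Pr :=
  hN.indep_primary_marks.comp measurable_id measurable_fst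

lemma indep_Y_g (hN : N.IsModel p Pr) :
    IndepFun (fun ω i => N.Y i ω) (fun ω i => N.g i ω) Pr :=
  hN.indep_secondary_marks.comp measurable_id measurable_fst

lemma measurable_harvested (hN : N.IsModel p Pr) : Measurable (N.harvested p) := by
  have : N.harvested p = fun ω => ENNReal.ofReal p.P₁ *
      ∑' i, received p p.TE (N.X i ω) (N.h i ω) := funext harvested_eq
  rw [this]
  exact (Measurable.tsum fun i => measurable_received_comp p _ (hN.measurable_X i)
    (hN.measurable_h i)).const_mul _

lemma measurable_I₁ (hN : N.IsModel p Pr) : Measurable (N.I₁ p) := by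
  rw [show N.I₁ p = _ from funext I₁_eq]
  exact ((Measurable.tsum fun i => measurable_received_comp p _ (hN.measurable_X i)
    (hN.measurable_h i)).const_mul _).const_mul _

lemma measurable_I₂ (hN : N.IsModel p Pr) : Measurable (N.I₂ p Pr) := by
  obtain ⟨F, hF, hFI⟩ := exists_measurable_I₂ N p Pr
  rw [show N.I₂ p Pr = _ from funext hFI]
  exact hF.comp ((measurable_pi_lambda _ hN.measurable_Y).prodMk
    ((measurable_pi_lambda _ hN.measurable_g).prodMk (measurable_pi_lambda _ hN.measurable_b)))

lemma indep_I₁_I₂ (hN : N.IsModel p Pr) : IndepFun (N.I₁ p) (N.I₂ p Pr) Pr := by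
  obtain ⟨F, hF, hFI⟩ := exists_measurable_I₁ N p
  obtain ⟨F', hF', hFI'⟩ := exists_measurable_I₂ N p Pr
  rw [show N.I₁ p = _ from funext hFI, show N.I₂ p Pr = _ from funext hFI']
  exact hN.indep_primary_secondary.comp hF hF'

lemma indep_h₀_I₁_add_I₂ (hN : N.IsModel p Pr) :
    IndepFun N.h₀ (fun ω => N.I₁ p ω + N.I₂ p Pr ω) Pr := by
  obtain ⟨F, hF, hFI⟩ := exists_measurable_I₁ N p
  obtain ⟨F', hF', hFI'⟩ := exists_measurable_I₂ N p Pr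
  rw [show (fun ω => N.I₁ p ω + N.I₂ p Pr ω) = _ from
    funext fun ω => congrArg₂ (· + ·) (hFI ω) (hFI' ω)]
  exact hN.indep_typical.comp measurable_id ((hF.comp measurable_fst).add (hF'.comp measurable_snd))

variable [IsProbabilityMeasure Pr]

lemma lintegral_harvested_lt_top (hN : N.IsModel p Pr) : ∫⁻ ω, N.harvested p ω ∂Pr < ∞ := by
  simp_rw [harvested_eq]
  rw [lintegral_const_mul' _ _ ENNReal.ofReal_ne_top]
  exact ENNReal.mul_lt_top ENNReal.ofReal_lt_top
    (lintegral_tsum_received_lt_top hN.primary hN.measurable_h hN.law_h hN.indep_X_h p _)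

lemma P₂_lt_top (hN : N.IsModel p Pr) : N.P₂ p Pr < ∞ := by
  have hT : ENNReal.ofReal p.TI ≠ 0 := (ENNReal.ofReal_pos.2 p.TI_pos).ne'
  have hle : ∀ ω, N.power p Pr ω ≤ (∫⁻ ω', N.harvested p ω' ∂Pr) / ENNReal.ofReal p.TI
      + ENNReal.ofReal p.sat / ENNReal.ofReal p.TI := by
    intro ω
    unfold power
    split_ifs
    exacts [zero_le, le_self_add, le_add_self]
  refine (lintegral_mono hle).trans_lt ?_
  rw [lintegral_const, measure_univ, mul_one]
  exact ENNReal.add_lt_top.2 ⟨ENNReal.div_lt_top hN.lintegral_harvested_lt_top.ne hT,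
    ENNReal.div_lt_top ENNReal.ofReal_ne_top hT⟩

lemma P₂_pos (hN : N.IsModel p Pr) : 0 < N.P₂ p Pr := by
  have hP := p.P₁_pos
  have hsat : 0 < p.sat := p.ε_pos.trans_le p.ε_le_sat
  obtain ⟨i, hi⟩ := exists_measure_received_pos hN.primary p.lam₁_pos hN.measurable_h hN.law_h
    hN.indep_X_h p p.TE_pos (p.sat / p.P₁)
  set S := {ω | ENNReal.ofReal p.sat ≤ N.harvested p ω} with hS
  have hSm : MeasurableSet S := measurableSet_le measurable_const hN.measurable_harvested
  have hSpos : 0 < Pr S := by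
    refine hi.trans_le (measure_mono fun ω hω => ?_)
    rw [hS, Set.mem_ofPred_eq, harvested_eq]
    calc ENNReal.ofReal p.sat = ENNReal.ofReal p.P₁ * ENNReal.ofReal (p.sat / p.P₁) := by
          rw [← ENNReal.ofReal_mul hP.le, mul_div_cancel₀ _ hP.ne']
      _ ≤ _ := mul_le_mul' le_rfl (le_trans hω (ENNReal.le_tsum i))
  calc 0 < ENNReal.ofReal p.sat / ENNReal.ofReal p.TI * Pr S :=
        ENNReal.mul_pos (ENNReal.div_pos (ENNReal.ofReal_pos.2 hsat).ne'
          ENNReal.ofReal_ne_top).ne' hSpos.ne'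
    _ = ∫⁻ _ in S, ENNReal.ofReal p.sat / ENNReal.ofReal p.TI ∂Pr := (setLIntegral_const _ _).symm
    _ ≤ ∫⁻ ω in S, N.power p Pr ω ∂Pr := by
        refine setLIntegral_mono' hSm fun ω hω => ?_
        have hω : ENNReal.ofReal p.sat ≤ N.harvested p ω := hω
        rw [power, if_neg (not_lt.2 ((ENNReal.ofReal_le_ofReal p.ε_le_sat).trans hω)),
          if_neg (not_lt.2 hω)]
    _ ≤ N.P₂ p Pr := setLIntegral_le_lintegral _ _

lemma inv_TI_ne_top (p : Params) : (ENNReal.ofReal p.TI)⁻¹ ≠ ∞ :=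
  ENNReal.inv_ne_top.2 (ENNReal.ofReal_pos.2 p.TI_pos).ne'

lemma ae_I₁_lt_top (hN : N.IsModel p Pr) : ∀ᵐ ω ∂Pr, N.I₁ p ω < ∞ := by
  have h := ae_lt_top (Measurable.tsum fun i => measurable_received_comp p p.TI
    (hN.measurable_X i) (hN.measurable_h i))
    (lintegral_tsum_received_lt_top hN.primary hN.measurable_h hN.law_h hN.indep_X_h p p.TI).ne
  filter_upwards [h] with ω hω
  rw [I₁_eq]
  exact ENNReal.mul_lt_top (inv_TI_ne_top p).lt_top (ENNReal.mul_lt_top ENNReal.ofReal_lt_top hω)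

lemma ae_I₂_lt_top (hN : N.IsModel p Pr) : ∀ᵐ ω ∂Pr, N.I₂ p Pr ω < ∞ := by
  have h := ae_lt_top (Measurable.tsum fun i => measurable_received_comp p p.TI
    (hN.measurable_Y i) (hN.measurable_g i))
    (lintegral_tsum_received_lt_top hN.secondary hN.measurable_g hN.law_g hN.indep_Y_g p p.TI).ne
  filter_upwards [h] with ω hω
  rw [I₂_eq]
  refine ENNReal.mul_lt_top (inv_TI_ne_top p).lt_top (ENNReal.mul_lt_top hN.P₂_lt_top
    (lt_of_le_of_lt (ENNReal.tsum_le_tsum fun i => ?_) hω))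
  split_ifs
  exacts [le_rfl, zero_le]

end IsModel
end Network

lemma ofReal_laplace {Ω : Type*} [MeasurableSpace Ω] {Pr : Measure Ω} [IsProbabilityMeasure Pr]
    {I : Ω → ℝ≥0∞} (hI : Measurable I) (hfin : ∀ᵐ ω ∂Pr, I ω < ∞) {s : ℝ} (hs : 0 ≤ s) :
    ENNReal.ofReal (laplace Pr I s) = ∫⁻ ω, expNeg (ENNReal.ofReal s * I ω) ∂Pr := by
  have hint : Integrable (fun ω => Real.exp (-s * (I ω).toReal)) Pr := by
    refine Integrable.of_bound (C := 1)
      (hI.ennreal_toReal.const_mul (-s)).exp.aestronglyMeasurable (ae_of_all _ fun ω => ?_)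
    rw [Real.norm_of_nonneg (Real.exp_nonneg _), Real.exp_le_one_iff]
    nlinarith [mul_nonneg hs (ENNReal.toReal_nonneg (a := I ω))]
  rw [laplace, ofReal_integral_eq_lintegral_ofReal hint (ae_of_all _ fun ω => Real.exp_nonneg _)]
  refine lintegral_congr_ae ?_
  filter_upwards [hfin] with ω hω
  rw [expNeg_of_ne_top (ENNReal.mul_ne_top ENNReal.ofReal_ne_top hω.ne), ENNReal.toReal_mul,
    ENNReal.toReal_ofReal hs, neg_mul]

lemma laplace_nonneg {Ω : Type*} [MeasurableSpace Ω] (Pr : Measure Ω) (I : Ω → ℝ≥0∞) (s : ℝ) :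
    0 ≤ laplace Pr I s := integral_nonneg fun _ => Real.exp_nonneg _

lemma closedForm_exponent_nonneg {α T a : ℝ} (hα : 2 < α) (hT : 0 < T) (ha : 0 < a) :
    0 ≤ 2 * Real.pi ^ 2 * T * csc (2 * Real.pi / α) *
        (((1 + a) ^ (2 / α) * (2 * a - α) + α) / (a * (2 + α))) := by
  have hα0 : 0 < α := by linarith
  have hcsc : 0 ≤ csc (2 * Real.pi / α) := by
    refine inv_nonneg.2 (Real.sin_nonneg_of_nonneg_of_le_pi (by positivity) ?_)
    rw [div_le_iff₀ hα0, mul_comm]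
    exact mul_le_mul_of_nonneg_left hα.le Real.pi_pos.le
  have hint := integral_mul_rpow (δ := 2 / α) (by positivity) ha
  have h0 : 0 ≤ ∫ v in (0 : ℝ)..1, a * v * (1 + a * v) ^ (2 / α - 1) :=
    intervalIntegral.integral_nonneg zero_le_one fun v hv => by
      have := hv.1
      positivity
  have h1 : ((1 + a) ^ (2 / α) * (2 * a - α) + α) / (a * (2 + α))
      = 2 / α * ∫ v in (0 : ℝ)..1, a * v * (1 + a * v) ^ (2 / α - 1) := by
    rw [hint]
    field_simp
  rw [h1]
  positivity

lemma expNeg_eq_closedForm {μ α T P s : ℝ} (hμ : 0 ≤ μ) (hα : 2 < α) (hT : 0 < T)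
    (ha : 0 < P * s) :
    expNeg (ENNReal.ofReal μ * ∫⁻ z : TimeSpace, ENNReal.ofReal
        (P * s * max 0 (1 - |z.2| / T) / (1 + P * s * max 0 (1 - |z.2| / T) + ‖z.1‖ ^ α)))
      = ENNReal.ofReal (laplaceClosedForm μ P T α s) := by
  rw [lintegral_timeSpace hα hT ha, ← ENNReal.ofReal_mul hμ, expNeg_ofReal
    (mul_nonneg hμ (closedForm_exponent_nonneg hα hT ha)), laplaceClosedForm]
  congr 3
  ring

lemma laplaceClosedForm_nonneg (μ P T α s : ℝ) : 0 ≤ laplaceClosedForm μ P T α s :=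
  Real.exp_nonneg _

namespace Network.IsModel

variable {Ω : Type*} [MeasurableSpace Ω] {Pr : Measure Ω} [IsProbabilityMeasure Pr]
  {N : Network Ω} {p : Params}

lemma laplace_I₁ (hN : N.IsModel p Pr) {s : ℝ} (hs : 0 < s) :
    laplace Pr (N.I₁ p) s = laplaceClosedForm p.lam₁ p.P₁ p.TI p.α s := by
  have hP := p.P₁_pos
  have := isSigmaFinite_intensity p.lam₁
  have hX : IsPoissonProcess Pr (ENNReal.ofReal p.lam₁ • volume) N.X := hN.primary
  rw [← ENNReal.ofReal_eq_ofReal_iff (laplace_nonneg _ _ _) (laplaceClosedForm_nonneg _ _ _ _ _),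
    ofReal_laplace hN.measurable_I₁ hN.ae_I₁_lt_top hs.le,
    ← expNeg_eq_closedForm p.lam₁_pos.le p.two_lt_α p.TI_pos (mul_pos hP hs)]
  have h1 : ∀ ω, ENNReal.ofReal s * N.I₁ p ω = ∑' i, ENNReal.ofReal (p.P₁ * s) *
      ((ENNReal.ofReal p.TI)⁻¹ * received p p.TI (N.X i ω) (N.h i ω)) := by
    intro ω
    rw [I₁_eq, ENNReal.tsum_mul_left, ENNReal.tsum_mul_left, ENNReal.ofReal_mul hP.le]
    ring
  simp_rw [h1]
  rw [hX.lintegral_expNeg_tsum_marks (G := fun z c => ENNReal.ofReal (p.P₁ * s) *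
      ((ENNReal.ofReal p.TI)⁻¹ * received p p.TI z c)) hN.measurable_h hN.indep_X_h
      hN.iIndep_h hN.law_h (((measurable_received p p.TI).const_mul _).const_mul _)]
  simp_rw [one_sub_lintegral_expNeg_received p (mul_pos hP hs).le]
  rw [lintegral_smul_measure, smul_eq_mul]

lemma lintegral_thinned_mark (hN : N.IsModel p Pr) {f : ℝ → ℝ≥0∞} (hf : Measurable f)
    (hf1 : ∀ c, f c ≤ 1) (i : ℕ) :
    1 - ∫⁻ m, (if m.2 = true then f m.1 else 1) ∂((expMeasure 1).prod (Pr.map (N.b i)))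
      = ENNReal.ofReal (N.transmitProb p Pr) * (1 - ∫⁻ c, f c ∂(expMeasure 1)) := by
  have := isProbabilityMeasure_expMeasure one_pos
  have : IsProbabilityMeasure (Pr.map (N.b i)) :=
    Measure.isProbabilityMeasure_map (hN.measurable_b i).aemeasurable
  set J := ∫⁻ c, f c ∂(expMeasure 1) with hJ
  have hJ1 : J ≤ 1 := (lintegral_mono hf1).trans (by simp)
  have hm : Measurable fun m : ℝ × Bool => if m.2 = true then f m.1 else 1 :=
    Measurable.ite (measurable_snd (measurableSet_singleton true)) (hf.comp measurable_fst)
      measurable_const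
  rw [lintegral_prod_symm _ hm.aemeasurable, lintegral_fintype, Fintype.sum_bool]
  have ht : Pr.map (N.b i) {true} = ENNReal.ofReal (N.transmitProb p Pr) := by
    rw [Measure.map_apply (hN.measurable_b i) (measurableSet_singleton _), ← hN.law_b i]
    rfl
  have hsum : Pr.map (N.b i) {true} + Pr.map (N.b i) {false} = 1 := by
    rw [← measure_union (by simp) (measurableSet_singleton _)]
    convert measure_univ (μ := Pr.map (N.b i))
    ext b; cases b <;> simp
  rw [← ht]
  generalize Pr.map (N.b i) {true} = q at hsum
  generalize Pr.map (N.b i) {false} = q' at hsum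
  have hq : q ≠ ∞ := ne_top_of_le_ne_top ENNReal.one_ne_top (hsum ▸ le_self_add)
  have hq' : q' ≠ ∞ := ne_top_of_le_ne_top ENNReal.one_ne_top (hsum ▸ le_add_self)
  have hJt : J ≠ ∞ := ne_top_of_le_ne_top ENNReal.one_ne_top hJ1
  simp only [if_true, ← hJ, Bool.false_eq_true, if_false, lintegral_const, measure_univ, one_mul]
  refine ENNReal.sub_eq_of_eq_add (ENNReal.add_ne_top.2 ⟨ENNReal.mul_ne_top hJt hq, hq'⟩) ?_
  rw [← add_assoc, mul_comm J, ← mul_add, tsub_add_cancel_of_le hJ1, mul_one, hsum]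

lemma laplace_I₂ (hN : N.IsModel p Pr) {s : ℝ} (hs : 0 < s) :
    laplace Pr (N.I₂ p Pr) s
      = laplaceClosedForm (N.activeDensity p Pr) (N.P₂ p Pr).toReal p.TI p.α s := by
  set P := (N.P₂ p Pr).toReal with hPdef
  have hP : 0 < P := ENNReal.toReal_pos hN.P₂_pos.ne' hN.P₂_lt_top.ne
  have hP' : N.P₂ p Pr = ENNReal.ofReal P := (ENNReal.ofReal_toReal hN.P₂_lt_top.ne).symm
  have := isSigmaFinite_intensity p.lam₂
  have hY : IsPoissonProcess Pr (ENNReal.ofReal p.lam₂ • volume) N.Y := hN.secondary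
  have hπ : 0 ≤ N.transmitProb p Pr := mul_nonneg measureReal_nonneg measureReal_nonneg
  have hind : ∀ i, IndepFun (N.g i) (N.b i) Pr := fun i =>
    hN.indep_g_b.comp (measurable_pi_apply i) (measurable_pi_apply i)
  have hb : ∀ i, Pr.map (N.b i) = Pr.map (N.b 0) := by
    intro i
    have := Measure.isProbabilityMeasure_map (μ := Pr) (hN.measurable_b i).aemeasurable
    have := Measure.isProbabilityMeasure_map (μ := Pr) (hN.measurable_b 0).aemeasurable
    have ht : Pr.map (N.b i) {true} = Pr.map (N.b 0) {true} := by
      rw [Measure.map_apply (hN.measurable_b i) (measurableSet_singleton _),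
        Measure.map_apply (hN.measurable_b 0) (measurableSet_singleton _)]
      exact (hN.law_b i).trans (hN.law_b 0).symm
    refine Measure.ext_of_singleton fun b => ?_
    cases b with
    | true => exact ht
    | false =>
      have hc : ({false} : Set Bool) = {true}ᶜ := by ext b; cases b <;> simp
      rw [hc, prob_compl_eq_one_sub (measurableSet_singleton _),
        prob_compl_eq_one_sub (measurableSet_singleton _), ht]
  have hlaw : ∀ i, Pr.map (fun ω => (N.g i ω, N.b i ω)) = (expMeasure 1).prod (Pr.map (N.b 0)) := by
    intro i
    rw [(indepFun_iff_map_prod_eq_prod_map_map (hN.measurable_g i).aemeasurable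
      (hN.measurable_b i).aemeasurable).1 (hind i), hN.law_g, hb]
  rw [activeDensity, ← ENNReal.ofReal_eq_ofReal_iff (laplace_nonneg _ _ _)
      (laplaceClosedForm_nonneg _ _ _ _ _), ofReal_laplace hN.measurable_I₂ hN.ae_I₂_lt_top hs.le,
    ← expNeg_eq_closedForm (mul_nonneg p.lam₂_pos.le hπ) p.two_lt_α p.TI_pos (mul_pos hP hs)]
  have h1 : ∀ ω, ENNReal.ofReal s * N.I₂ p Pr ω = ∑' i, if (N.g i ω, N.b i ω).2 = true then
      ENNReal.ofReal (P * s) *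
      ((ENNReal.ofReal p.TI)⁻¹ * received p p.TI (N.Y i ω) (N.g i ω, N.b i ω).1) else 0 := by
    intro ω
    simp_rw [I₂_eq, hP', ← mul_ite_zero, ENNReal.tsum_mul_left, ENNReal.ofReal_mul hP.le]
    ring
  simp_rw [h1]
  have hGm : Measurable fun q : TimeSpace × ℝ × Bool => if q.2.2 = true then
      ENNReal.ofReal (P * s) * ((ENNReal.ofReal p.TI)⁻¹ * received p p.TI q.1 q.2.1) else 0 := by
    refine Measurable.ite ?_ (Measurable.const_mul (Measurable.const_mul
      (measurable_received_comp p p.TI (by fun_prop) (by fun_prop)) _) _) measurable_const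
    exact (by fun_prop : Measurable fun q : TimeSpace × ℝ × Bool => q.2.2)
      (measurableSet_singleton true)
  have hindm : IndepFun (fun ω i => N.Y i ω) (fun ω i => (N.g i ω, N.b i ω)) Pr :=
    hN.indep_secondary_marks.comp measurable_id (by fun_prop :
      Measurable fun q : (ℕ → ℝ) × (ℕ → Bool) => fun i => (q.1 i, q.2 i))
  rw [hY.lintegral_expNeg_tsum_marks (m := fun i ω => (N.g i ω, N.b i ω))
      (G := fun z m => if m.2 = true then ENNReal.ofReal (P * s) *
      ((ENNReal.ofReal p.TI)⁻¹ * received p p.TI z m.1) else 0)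
      (fun i => (hN.measurable_g i).prodMk (hN.measurable_b i)) hindm
      (iIndepFun_prodMk hN.measurable_g hN.measurable_b hN.iIndep_g hN.iIndep_b hN.indep_g_b)
      hlaw hGm]
  have h2 : ∀ z : TimeSpace, 1 - ∫⁻ m, expNeg (if m.2 = true then ENNReal.ofReal (P * s) *
      ((ENNReal.ofReal p.TI)⁻¹ * received p p.TI z m.1) else 0)
        ∂((expMeasure 1).prod (Pr.map (N.b 0)))
      = ENNReal.ofReal (N.transmitProb p Pr) * ENNReal.ofReal (P * s *
        max 0 (1 - |z.2| / p.TI) / (1 + P * s * max 0 (1 - |z.2| / p.TI) + ‖z.1‖ ^ p.α)) := by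
    intro z
    have hm : Measurable fun c => expNeg (ENNReal.ofReal (P * s) *
        ((ENNReal.ofReal p.TI)⁻¹ * received p p.TI z c)) :=
      measurable_expNeg.comp (Measurable.const_mul (Measurable.const_mul
        (measurable_received_comp p p.TI measurable_const measurable_id) _) _)
    rw [← one_sub_lintegral_expNeg_received p (mul_pos hP hs).le,
      ← hN.lintegral_thinned_mark hm (fun c => expNeg_le_one _) 0]
    simp_rw [apply_ite expNeg, expNeg_zero]
  simp_rw [h2]
  rw [lintegral_smul_measure, smul_eq_mul, lintegral_const_mul' _ _ ENNReal.ofReal_ne_top,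
    ← mul_assoc, ← ENNReal.ofReal_mul p.lam₂_pos.le]

lemma measure_h₀_ge (hN : N.IsModel p Pr) {J : Ω → ℝ≥0∞} (hJ : Measurable J)
    (hind : IndepFun N.h₀ J Pr) :
    Pr {ω | J ω ≤ ENNReal.ofReal (N.h₀ ω) ∧ 0 < N.h₀ ω} = ∫⁻ ω, expNeg (J ω) ∂Pr := by
  have hS : MeasurableSet {q : ℝ≥0∞ × ℝ | q.1 ≤ ENNReal.ofReal q.2 ∧ 0 < q.2} :=
    (measurableSet_le measurable_fst (by fun_prop)).inter
      (measurable_snd measurableSet_Ioi)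
  have hlaw := (indepFun_iff_map_prod_eq_prod_map_map hJ.aemeasurable
    hN.measurable_h₀.aemeasurable).1 hind.symm
  have := isProbabilityMeasure_expMeasure one_pos
  have h1 := Measure.map_apply (μ := Pr) (hJ.prodMk hN.measurable_h₀) hS
  rw [hlaw, hN.law_h₀, Measure.prod_apply hS] at h1
  refine h1.symm.trans ?_
  have h2 : ∀ z : ℝ≥0∞, expMeasure 1 (Prod.mk z ⁻¹'
      {q : ℝ≥0∞ × ℝ | q.1 ≤ ENNReal.ofReal q.2 ∧ 0 < q.2}) = expNeg z :=
    expMeasure_one_ofReal_ge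
  simp_rw [h2]
  exact lintegral_map measurable_expNeg hJ

lemma ae_h₀_pos (hN : N.IsModel p Pr) : ∀ᵐ ω ∂Pr, 0 < N.h₀ ω := by
  have h := hN.measure_h₀_ge (J := fun _ => 0) measurable_const (indepFun_const_right _ _)
  simp only [zero_le, true_and, expNeg_zero, lintegral_const, measure_univ, mul_one] at h
  exact (prob_compl_eq_zero_iff (hN.measurable_h₀ measurableSet_Ioi)).2 h

lemma coverage₁_eq (hN : N.IsModel p Pr) {ζ : ℝ} (hζ : 0 < ζ) {s : ℝ}
    (hs : s = ζ * (1 + p.d ^ p.α) / p.P₁) :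
    N.coverage₁ p Pr ζ = laplace Pr (N.I₁ p) s * laplace Pr (N.I₂ p Pr) s *
      Real.exp (-(p.σ ^ 2 * s)) := by
  have hP := p.P₁_pos
  have hd : 0 < 1 + p.d ^ p.α := by
    have := Real.rpow_nonneg p.d_nonneg p.α
    positivity
  have hs0 : 0 < s := by rw [hs]; positivity
  set J := fun ω => N.I₁ p ω + N.I₂ p Pr ω with hJ
  have hJm : Measurable J := hN.measurable_I₁.add hN.measurable_I₂
  have hcomp : Measurable fun x : ℝ≥0∞ => ENNReal.ofReal s * (x + ENNReal.ofReal (p.σ ^ 2)) := by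
    fun_prop
  have hae : {ω | ENNReal.ofReal ζ ≤ N.SINR₁ p Pr ω} =ᵐ[Pr]
      {ω | ENNReal.ofReal s * (J ω + ENNReal.ofReal (p.σ ^ 2)) ≤ ENNReal.ofReal (N.h₀ ω)
        ∧ 0 < N.h₀ ω} := by
    filter_upwards [hN.ae_h₀_pos] with ω hω
    have hpl : 0 < p.P₁ * pathLoss p.α p.d := mul_pos hP (inv_pos.2 hd)
    have hnum : p.P₁ * N.h₀ ω * pathLoss p.α p.d = p.P₁ * pathLoss p.α p.d * N.h₀ ω := by ring
    have hζs : ζ = p.P₁ * pathLoss p.α p.d * s := by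
      rw [hs, pathLoss]; field_simp
    have h0 : ENNReal.ofReal (p.P₁ * pathLoss p.α p.d) ≠ 0 := (ENNReal.ofReal_pos.2 hpl).ne'
    refine propext ?_
    change ENNReal.ofReal ζ ≤ N.SINR₁ p Pr ω ↔ _ ∧ _
    rw [SINR₁, ENNReal.le_div_iff_mul_le
      (Or.inr (by rw [hnum]; exact (ENNReal.ofReal_pos.2 (mul_pos hpl hω)).ne'))
      (Or.inr ENNReal.ofReal_ne_top), hnum, hζs, ENNReal.ofReal_mul hpl.le,
      ENNReal.ofReal_mul hpl.le, mul_assoc, ENNReal.mul_le_mul_iff_right h0 ENNReal.ofReal_ne_top]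
    exact (and_iff_left hω).symm
  have hsplit : ∀ ω, expNeg (ENNReal.ofReal s * (J ω + ENNReal.ofReal (p.σ ^ 2)))
      = expNeg (ENNReal.ofReal s * N.I₁ p ω) * expNeg (ENNReal.ofReal s * N.I₂ p Pr ω) *
        ENNReal.ofReal (Real.exp (-(p.σ ^ 2 * s))) := by
    intro ω
    rw [hJ, mul_add, mul_add, expNeg_add, expNeg_add, ← ENNReal.ofReal_mul hs0.le,
      expNeg_ofReal (by positivity), mul_comm s]
  have hm : Measurable fun x : ℝ≥0∞ => expNeg (ENNReal.ofReal s * x) := by fun_prop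
  rw [coverage₁, Measure.real, measure_congr hae, hN.measure_h₀_ge
    (J := fun ω => ENNReal.ofReal s * (J ω + ENNReal.ofReal (p.σ ^ 2))) (hcomp.comp hJm)
    (hN.indep_h₀_I₁_add_I₂.comp measurable_id hcomp)]
  simp_rw [hsplit]
  rw [lintegral_mul_const' _ _ ENNReal.ofReal_ne_top,
    lintegral_mul_eq_lintegral_mul_lintegral_of_indepFun''
      (f := fun ω => expNeg (ENNReal.ofReal s * N.I₁ p ω))
      (g := fun ω => expNeg (ENNReal.ofReal s * N.I₂ p Pr ω))
      (hm.comp hN.measurable_I₁).aemeasurable (hm.comp hN.measurable_I₂).aemeasurable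
      (hN.indep_I₁_I₂.comp hm hm),
    ← ofReal_laplace hN.measurable_I₁ hN.ae_I₁_lt_top hs0.le,
    ← ofReal_laplace hN.measurable_I₂ hN.ae_I₂_lt_top hs0.le, ENNReal.toReal_mul,
    ENNReal.toReal_mul, ENNReal.toReal_ofReal (laplace_nonneg _ _ _),
    ENNReal.toReal_ofReal (laplace_nonneg _ _ _), ENNReal.toReal_ofReal (Real.exp_nonneg _)]

end Network.IsModel

end AdHoc

end

theorem theorem1 {Ω : Type*} [MeasurableSpace Ω] (Pr : MeasureTheory.Measure Ω)
    [MeasureTheory.IsProbabilityMeasure Pr] (p : AdHoc.Params) (N : AdHoc.Network Ω)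
    (hN : N.IsModel p Pr) :
    (0 < N.P₂ p Pr ∧ N.P₂ p Pr < ∞) ∧
    (∀ᵐ ω ∂Pr, N.I₁ p ω < ∞) ∧
    (∀ᵐ ω ∂Pr, N.I₂ p Pr ω < ∞) ∧
    (∀ ζ : ℝ, 0 < ζ → ∀ s : ℝ, s = ζ * (1 + p.d ^ p.α) / p.P₁ →
      N.coverage₁ p Pr ζ =
        AdHoc.laplace Pr (N.I₁ p) s * AdHoc.laplace Pr (N.I₂ p Pr) s *
          Real.exp (-(p.σ ^ 2 * s))) ∧
    (∀ s : ℝ, 0 < s →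
      AdHoc.laplace Pr (N.I₁ p) s = AdHoc.laplaceClosedForm p.lam₁ p.P₁ p.TI p.α s) ∧
    (∀ s : ℝ, 0 < s →
      AdHoc.laplace Pr (N.I₂ p Pr) s =
        AdHoc.laplaceClosedForm (N.activeDensity p Pr) (N.P₂ p Pr).toReal p.TI p.α s) := by
  exact ⟨⟨hN.P₂_pos, hN.P₂_lt_top⟩, hN.ae_I₁_lt_top, hN.ae_I₂_lt_top,
    fun _ hζ _ hs => hN.coverage₁_eq hζ hs, fun _ hs => hN.laplace_I₁ hs,
    fun _ hs => hN.laplace_I₂ hs⟩
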